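/- Let $\Omega\subset\mathbb R^2$ be a bounded convex polygonal domain, $\mathcal T^h$ a (conforming) triangulation of $\Omega$, and $f\in L_2(\Omega)$. Let $(\cdot,\cdot)$ denote the inner products of $L_2(\Omega)$ and $L_2(\Omega)^2$, and let $\nabla_h$ be the element-wise gradient. For a triangle $K\in\mathcal T^h$ with vertices $x^{(1)},x^{(2)},x^{(3)}$ let $x^G$ be its barycenter, and set $\overline f_K=\int_K f\,dx/\mathrm{meas}(K)$. Let - $X^h$ be the space of step functions over $\mathcal T^h$ (constant on each $K$) and $Q_h:L_2(\Omega)\to X^h$ the $L_2$-orthogonal projection, so that $Q_hf|_K=\overline f_K$; - $V^h$ be the non-conforming $P_1$ space: functions that are affine on each $K\in\mathcal T^h$, continuous at the midpoints of the edges, and zero at the edge midpoints on $\partial\Omega$; - $V^h_B=\mathrm{span}\{\varphi_K: K\in\mathcal T^h\}$, where $\varphi_K$ vanishes outside $K$ and $\varphi_K(x)=\frac12|x-x^G|^2-\frac1{12}\sum_{i=1}^3|x^{(i)}-x^G|^2$ for $x\in K$, and $\tilde V^h=V^h+V^h_B$; - $W^h$ be the lowest-order Raviart–Thomas space: vector fields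 of the form $a_K+c_Kx$ ($a_K\in\mathbb R^2$, $c_K\in\mathbb R$) on each $K\in\mathcal T^h$ whose normal component is continuous across each inter-element edge. Then $V^h\cap V^h_B=\{0\}$, i.e. $\tilde V^h=V^h\oplus V^h_B$, and each of the following problems has a unique solution: find $u_h^*\in V^h$, $\alpha_h\in V_B^h$, $\tilde u_h\in\tilde V^h$ such that $$(\nabla_hu_h^*,\nabla_hv_h)=(Q_hf,v_h)\ \ \forall v_h\in V^h,\qquad (\nabla_h\alpha_h,\nabla_h\beta_h)=(Q_hf,\beta_h)\ \ \forall\beta_h\in V^h_B,\qquad (\nabla_h\tilde u_h,\nabla_h\tilde v_h)=(Q_hf,\tilde v_h)\ \ \forall\tilde v_h\in\tilde V^h.$$ The pair $p_h=\nabla_h\tilde u_h$, $\overline u_h=Q_h\tilde u_h$ belongs to $W^h\times X^h$ and is the unique solution in $W^h\times X^h$ of the lowest-order Raviart–Thomas mixed finite element method $$(p_h,q_h)+(\overline u_h,\mathrm{div}\,q_h)=0\ \ \forall q_h\in W^h,\qquad (\mathrm{div}\,p_h,\overline v_h)=-(Q_hf,\overline v_h)\ \ \forall\overline v_h\in X^h.$$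 Moreover $\tilde u_h=u_h^*+\alpha_h$, and for every $K\in\mathcal T^h$: the equation $\alpha_K(\nabla\varphi_K,\nabla\varphi_K)_{K}=(Q_hf,\varphi_K)_{K}$ (inner products over $K$) has the unique solution $\alpha_K=-\frac12\overline f_K$, one has $\alpha_h|_K=\alpha_K\varphi_K|_K$, and for all $x\in K$ $$\tilde u_h(x)=u_h^*(x)-\tfrac14\overline f_K\Big(|x-x^G|^2-\tfrac16\sum_{i=1}^3|x^{(i)}-x^G|^2\Big),$$ $$p_h(x)=\nabla_hu_h^*(x)-\tfrac12\overline f_K(x-x^G),\qquad \overline u_h(x)=u_h^*(x^G)-\tfrac1{16}\overline f_K\Big(|x^G|^2-\tfrac13\sum_{i=1}^3|x^{(i)}|^2\Big).$$ (Values of piecewise defined functions at points $x\in\partial K$ are those of the polynomial on $K$.) -/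

import Mathlib

open MeasureTheory

noncomputable section

namespace CRMixed

/-- The Euclidean plane. -/
abbrev Plane : Type := EuclideanSpace ℝ (Fin 2)

/-- A bounded convex polygonal domain: a nonempty bounded convex open set whose closure is the
convex hull of finitely many points. -/
structure IsConvexPolygonalDomain (Ω : Set Plane) : Prop where
  isOpen : IsOpen Ω
  nonempty : Ω.Nonempty
  isBounded : Bornology.IsBounded Ω
  convex : Convex ℝ Ω
  polygonal : ∃ S : Finset Plane, closure Ω = convexHull ℝ (S : Set Plane)

/-- A (conforming) triangulation of `Ω`. A closed nondegenerate triangle is given by the set of its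
three vertices. Two triangles meet exactly in the convex hull of their common vertices, i.e. for
distinct triangles in the empty set, a common vertex or a common edge. -/
structure Triangulation (Ω : Set Plane) where
  elems : Finset (Finset Plane)
  card_eq : ∀ K ∈ elems, K.card = 3
  affineIndependent : ∀ K ∈ elems, AffineIndependent ℝ (fun x : K => (x : Plane))
  inter_eq : ∀ K ∈ elems, ∀ L ∈ elems,
    convexHull ℝ (K : Set Plane) ∩ convexHull ℝ (L : Set Plane)
      = convexHull ℝ ((K : Set Plane) ∩ (L : Set Plane))
  cover : ⋃ K ∈ elems, convexHull ℝ (K : Set Plane) = closure Ω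

/-- The closed triangle with vertex set `K`. -/
def tri (K : Finset Plane) : Set Plane := convexHull ℝ (K : Set Plane)

/-- The barycenter `x^G` of the triangle with vertex set `K`. -/
def bary (K : Finset Plane) : Plane := (1 / 3 : ℝ) • ∑ v ∈ K, v

/-- The quadratic bubble on the triangle with vertex set `K`:
`½ |x - x^G|² - (1/12) ∑ᵢ |x⁽ⁱ⁾ - x^G|²`. -/
def bubble (K : Finset Plane) (x : Plane) : ℝ :=
  1 / 2 * ‖x - bary K‖ ^ 2 - 1 / 12 * ∑ v ∈ K, ‖v - bary K‖ ^ 2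

/-- The divergence `∂₁ q₁ + ∂₂ q₂`. -/
def divergence (q : Plane → Plane) (x : Plane) : ℝ :=
  ∑ i : Fin 2, (fderiv ℝ q x (EuclideanSpace.single i 1)) i

namespace Triangulation

variable {Ω : Set Plane} (T : Triangulation Ω)

/-- Element-wise defined (broken) scalar functions: one function for each triangle `K`, of which
only the restriction to `K` matters. The members of all finite element spaces below are polynomial
on each triangle, so the restriction to `K` determines the function `v K`. A function `g` on `Ω`
is the broken function `fun _ => g`. -/
abbrev BrokenFun : Type := T.elems → Plane → ℝ

/-- Element-wise defined (broken) vector fields. -/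
abbrev BrokenField : Type := T.elems → Plane → Plane

/-- The inner product of `L₂(Ω)`. -/
def innerS (u v : T.BrokenFun) : ℝ := ∑ K : T.elems, ∫ x in tri K, u K x * v K x

/-- The inner product of `L₂(Ω)²`. -/
def innerV (p q : T.BrokenField) : ℝ := ∑ K : T.elems, ∫ x in tri K, inner ℝ (p K x) (q K x)

/-- The discrete gradient `∇_h`, taken element by element. -/
def gradh (v : T.BrokenFun) : T.BrokenField := fun K => gradient (v K)

/-- The divergence, taken element by element. -/
def divh (q : T.BrokenField) : T.BrokenFun := fun K => divergence (q K)

/-- `X^h`: the step functions over the triangulation. -/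
def X : Submodule ℝ T.BrokenFun where
  carrier := {v | ∀ K, ∃ c : ℝ, ∀ x, v K x = c}
  zero_mem' := fun _ => ⟨0, fun _ => rfl⟩
  add_mem' := by
    intro u v hu hv K
    obtain ⟨c, hc⟩ := hu K
    obtain ⟨d, hd⟩ := hv K
    exact ⟨c + d, fun x => by simp [hc, hd]⟩
  smul_mem' := by
    intro r u hu K
    obtain ⟨c, hc⟩ := hu K
    exact ⟨r * c, fun x => by simp [hc]⟩

/-- The mean value of a broken function over the triangle `K`. -/
def mean (g : T.BrokenFun) (K : T.elems) : ℝ := (∫ x in tri K, g K x) / volume.real (tri K)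

/-- The `L₂`-orthogonal projection `Q_h` onto the step functions, i.e. the element-wise mean value;
see `Qh_mem` and `innerS_sub_Qh`. -/
def Qh (g : T.BrokenFun) : T.BrokenFun := fun K _ => T.mean g K

theorem Qh_mem (g : T.BrokenFun) : T.Qh g ∈ T.X := fun K => ⟨T.mean g K, fun _ => rfl⟩

theorem innerS_sub_Qh (g : T.BrokenFun) (hg : ∀ K, MemLp (g K) 2 (volume.restrict (tri K)))
    (w : T.BrokenFun) (hw : w ∈ T.X) : T.innerS (g - T.Qh g) w = 0 := by
  refine Finset.sum_eq_zero fun K _ => ?_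
  obtain ⟨c, hc⟩ := hw K
  have hlt : volume (tri (K : Finset Plane)) < ⊤ :=
    ((Finset.finite_toSet (K : Finset Plane)).isCompact_convexHull ℝ).measure_lt_top
  have hfin : IsFiniteMeasure (volume.restrict (tri (K : Finset Plane))) :=
    ⟨by simpa using hlt⟩
  have hint : Integrable (g K) (volume.restrict (tri K)) := (hg K).integrable (by norm_num)
  simp only [hc, Pi.sub_apply, integral_mul_const, Qh]
  rw [integral_sub hint (integrable_const (T.mean g K))]
  simp only [mean, integral_const, smul_eq_mul, measureReal_restrict_apply_univ]
  by_cases h0 : volume.real (tri (K : Finset Plane)) = 0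
  · have : volume (tri (K : Finset Plane)) = 0 := by
      rcases (ENNReal.toReal_eq_zero_iff _).1 h0 with h | h
      · exact h
      · exact absurd h hlt.ne
    rw [Measure.restrict_eq_zero.2 this]
    simp
  · field_simp
    simp

/-- The non-conforming `P₁` space `V^h`: affine on each triangle, continuous at the midpoints of
the edges, and zero at the midpoints lying on the boundary of `Ω`. -/
def V : Submodule ℝ T.BrokenFun where
  carrier := {v |
    (∀ K, ∃ a : Plane →ᵃ[ℝ] ℝ, ∀ x, v K x = a x) ∧
    (∀ K L : T.elems, ∀ a b : Plane, a ≠ b → a ∈ K.1 → b ∈ K.1 → a ∈ L.1 → b ∈ L.1 →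
      v K (midpoint ℝ a b) = v L (midpoint ℝ a b)) ∧
    (∀ K : T.elems, ∀ a b : Plane, a ≠ b → a ∈ K.1 → b ∈ K.1 → midpoint ℝ a b ∈ frontier Ω →
      v K (midpoint ℝ a b) = 0)}
  zero_mem' := ⟨fun _ => ⟨0, fun _ => rfl⟩, fun _ _ _ _ _ _ _ _ _ => rfl, fun _ _ _ _ _ _ _ => rfl⟩
  add_mem' := by
    rintro u v ⟨hu1, hu2, hu3⟩ ⟨hv1, hv2, hv3⟩
    refine ⟨fun K => ?_, fun K L a b h h1 h2 h3 h4 => ?_, fun K a b h h1 h2 h3 => ?_⟩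
    · obtain ⟨a, ha⟩ := hu1 K
      obtain ⟨b, hb⟩ := hv1 K
      exact ⟨a + b, fun x => by simp [ha, hb]⟩
    · simp only [Pi.add_apply]
      rw [hu2 K L a b h h1 h2 h3 h4, hv2 K L a b h h1 h2 h3 h4]
    · simp only [Pi.add_apply]
      rw [hu3 K a b h h1 h2 h3, hv3 K a b h h1 h2 h3, add_zero]
  smul_mem' := by
    rintro r u ⟨hu1, hu2, hu3⟩
    refine ⟨fun K => ?_, fun K L a b h h1 h2 h3 h4 => ?_, fun K a b h h1 h2 h3 => ?_⟩
    · obtain ⟨a, ha⟩ := hu1 K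
      exact ⟨r • a, fun x => by simp [ha]⟩
    · simp only [Pi.smul_apply]
      rw [hu2 K L a b h h1 h2 h3 h4]
    · simp only [Pi.smul_apply]
      rw [hu3 K a b h h1 h2 h3, smul_zero]

open Classical in
/-- The basis bubble `φ_K`: the quadratic bubble on `K`, zero on the other triangles. -/
def phi (K : T.elems) : T.BrokenFun := Pi.single K (bubble K)

/-- The bubble space `V_B^h`. -/
def VB : Submodule ℝ T.BrokenFun := Submodule.span ℝ (Set.range T.phi)

/-- The enriched space `V^h + V_B^h`. -/
def Vt : Submodule ℝ T.BrokenFun := T.V ⊔ T.VB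

/-- The lowest-order Raviart–Thomas space `W^h`: fields of the form `a + c x` on each triangle,
with normal component continuous across the common edges. -/
def W : Submodule ℝ T.BrokenField where
  carrier := {q |
    (∀ K, ∃ (a : Plane) (c : ℝ), ∀ x, q K x = a + c • x) ∧
    (∀ K L : T.elems, ∀ a b : Plane, a ≠ b → a ∈ K.1 → b ∈ K.1 → a ∈ L.1 → b ∈ L.1 →
      ∀ n : Plane, inner ℝ n (b - a) = 0 → ∀ x ∈ segment ℝ a b,
        inner ℝ (q K x) n = inner ℝ (q L x) n)}
  zero_mem' := ⟨fun _ => ⟨0, 0, fun _ => by simp⟩, fun _ _ _ _ _ _ _ _ _ _ _ _ _ => rfl⟩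
  add_mem' := by
    rintro p q ⟨hp1, hp2⟩ ⟨hq1, hq2⟩
    refine ⟨fun K => ?_, fun K L a b h h1 h2 h3 h4 n hn x hx => ?_⟩
    · obtain ⟨a, c, ha⟩ := hp1 K
      obtain ⟨b, d, hb⟩ := hq1 K
      exact ⟨a + b, c + d, fun x => by simp only [Pi.add_apply, ha, hb]; module⟩
    · simp only [Pi.add_apply, inner_add_left]
      rw [hp2 K L a b h h1 h2 h3 h4 n hn x hx, hq2 K L a b h h1 h2 h3 h4 n hn x hx]
  smul_mem' := by
    rintro r p ⟨hp1, hp2⟩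
    refine ⟨fun K => ?_, fun K L a b h h1 h2 h3 h4 n hn x hx => ?_⟩
    · obtain ⟨a, c, ha⟩ := hp1 K
      exact ⟨r • a, r * c, fun x => by simp only [Pi.smul_apply, ha]; module⟩
    · simp only [Pi.smul_apply, inner_smul_left]
      rw [hp2 K L a b h h1 h2 h3 h4 n hn x hx]

/-- `u ∈ S` solves `(∇_h u, ∇_h v) = (F, v)` for all `v ∈ S`. -/
def IsGalerkinSolution (S : Submodule ℝ T.BrokenFun) (F u : T.BrokenFun) : Prop :=
  u ∈ S ∧ ∀ v ∈ S, T.innerV (T.gradh u) (T.gradh v) = T.innerS F v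

/-- `(p, ubar) ∈ W^h × X^h` solves the lowest-order Raviart–Thomas mixed method with load `F`. -/
def IsMixedSolution (F : T.BrokenFun) (p : T.BrokenField) (ubar : T.BrokenFun) : Prop :=
  p ∈ T.W ∧ ubar ∈ T.X ∧
  (∀ q ∈ T.W, T.innerV p q + T.innerS ubar (T.divh q) = 0) ∧
  (∀ v ∈ T.X, T.innerS (T.divh p) v = -T.innerS F v)

end Triangulation

end CRMixed

end

open MeasureTheory

noncomputable section

namespace CRMixed

open Filter Topology

/-! On each triangle, scalar functions are written as `quad K c g s` and vector fields as `rt K g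
s`, expanded about the barycenter. Linear terms then integrate to zero and a single constant,
`secondMoment K`, carries the quadratic part, so every inner product becomes a finite sum weighted
by the areas (`setIntegral_quad`, `setIntegral_inner_rt`).

In these coordinates a bubble gradient is a multiple of `x - x^G`, of mean zero on its triangle and
hence orthogonal to the piecewise constant gradients of `V`. The enriched problem therefore splits
into the problem on `V` and a diagonal problem for the bubbles with coefficients `-F K / 2`
(`galerkin_Vt_iff`, `galerkin_VB_iff`).

The link with the mixed method is a discrete Green formula (`Triangulation.green`). The normal flux
of a Raviart–Thomas field is constant along an edge, so against an affine function only the edge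
midpoint values matter. Contributions cancel in pairs across interior edges and vanish on the
boundary. Conversely, testing with the basis function of an interior edge shows that a field
satisfying this formula against all of `V` has continuous normal flux (`rt_mem_W_of_forall_V`). The
Galerkin equation on `V` is exactly this condition for the field with element gradients `g` and
divergence `-F`.

Two further consequences of Green's formula replace analytic tools. Applied to the field `q(x) = x`,
it makes the discrete gradient injective on `V`. And since the problem on `V` is solvable for any
step function as load, the divergence maps `W` onto the step functions, which gives uniqueness of
the scalar part of the mixed solution. -/

/-! ### Integration over triangles by reduction to the reference triangle -/

/-- The planar cross product. -/
def cross (x y : Plane) : ℝ := x 0 * y 1 - x 1 * y 0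

/-- The reference triangle. -/
def refTri : Set Plane := {y | 0 ≤ y 0 ∧ 0 ≤ y 1 ∧ y 0 + y 1 ≤ 1}

theorem isClosed_refTri : IsClosed refTri := by
  have h0 : IsClosed {y : Plane | 0 ≤ y 0} := isClosed_le (by fun_prop) (by fun_prop)
  have h1 : IsClosed {y : Plane | 0 ≤ y 1} := isClosed_le (by fun_prop) (by fun_prop)
  have h2 : IsClosed {y : Plane | y 0 + y 1 ≤ 1} := isClosed_le (by fun_prop) (by fun_prop)
  exact h0.inter (h1.inter h2)

theorem setIntegral_refTri {h : ℝ × ℝ → ℝ} (hh : Continuous h) :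
    ∫ y in refTri, h (y 0, y 1) = ∫ s in (0 : ℝ)..1, ∫ t in (0 : ℝ)..(1 - s), h (s, t) := by
  set R : Set (ℝ × ℝ) := {z | 0 ≤ z.1 ∧ 0 ≤ z.2 ∧ z.1 + z.2 ≤ 1} with hR
  have hRc : IsClosed R := by
    have h0 : IsClosed {z : ℝ × ℝ | 0 ≤ z.1} := isClosed_le (by fun_prop) (by fun_prop)
    have h1 : IsClosed {z : ℝ × ℝ | 0 ≤ z.2} := isClosed_le (by fun_prop) (by fun_prop)
    have h2 : IsClosed {z : ℝ × ℝ | z.1 + z.2 ≤ 1} := isClosed_le (by fun_prop) (by fun_prop)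
    exact h0.inter (h1.inter h2)
  have hRK : IsCompact R := by
    refine (isCompact_Icc (a := ((0 : ℝ), (0 : ℝ))) (b := (1, 1))).of_isClosed_subset hRc ?_
    rintro ⟨s, t⟩ ⟨h1, h2, h3⟩
    simp only at h1 h2 h3
    exact ⟨⟨h1, h2⟩, ⟨by simp only; linarith, by simp only; linarith⟩⟩
  have hmp := (volume_preserving_finTwoArrow ℝ).comp
    (EuclideanSpace.volume_preserving_symm_measurableEquiv_toLp (Fin 2))
  have hme : MeasurableEmbedding ((MeasurableEquiv.finTwoArrow : (Fin 2 → ℝ) ≃ᵐ ℝ × ℝ) ∘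
      (MeasurableEquiv.toLp 2 (Fin 2 → ℝ)).symm) :=
    MeasurableEquiv.finTwoArrow.measurableEmbedding.comp
      (MeasurableEquiv.toLp 2 (Fin 2 → ℝ)).symm.measurableEmbedding
  have h1 := hmp.setIntegral_preimage_emb hme h R
  have h2 : ∫ y in refTri, h (y 0, y 1) = ∫ z in R, h z := h1
  rw [h2, ← integral_indicator hRc.measurableSet, Measure.volume_eq_prod, integral_prod]
  · rw [intervalIntegral.integral_of_le zero_le_one, ← integral_Icc_eq_integral_Ioc,
      ← integral_indicator measurableSet_Icc]
    refine integral_congr_ae (Filter.Eventually.of_forall fun s => ?_)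
    by_cases hs : s ∈ Set.Icc (0 : ℝ) 1
    · simp only [Set.indicator_of_mem hs]
      rw [intervalIntegral.integral_of_le (by linarith [hs.2]), ← integral_Icc_eq_integral_Ioc,
        ← integral_indicator measurableSet_Icc]
      refine integral_congr_ae (Filter.Eventually.of_forall fun t => ?_)
      have : (s, t) ∈ R ↔ t ∈ Set.Icc 0 (1 - s) :=
        ⟨fun h => ⟨h.2.1, by linarith [h.2.2]⟩, fun h => ⟨hs.1, h.1, by linarith [h.2]⟩⟩
      by_cases ht : t ∈ Set.Icc 0 (1 - s)
      · simp only [Set.indicator_of_mem ht, Set.indicator_of_mem (this.2 ht)]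
      · simp only [Set.indicator_of_notMem ht, Set.indicator_of_notMem (mt this.1 ht)]
    · simp only [Set.indicator_of_notMem hs]
      rw [← integral_zero ℝ ℝ]
      refine integral_congr_ae (Filter.Eventually.of_forall fun t => ?_)
      refine Set.indicator_of_notMem (fun h => hs ⟨h.1, ?_⟩) _
      have h2 := h.2.1
      have h3 := h.2.2
      simp only at h2 h3
      linarith
  · rw [← Measure.volume_eq_prod, integrable_indicator_iff hRc.measurableSet]
    exact hh.continuousOn.integrableOn_compact hRK

theorem setIntegral_refTri_quadratic (A B C D E F : ℝ) :
    ∫ y in refTri, (A + B * y 0 + C * y 1 + D * y 0 ^ 2 + E * (y 0 * y 1) + F * y 1 ^ 2)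
      = A / 2 + B / 6 + C / 6 + D / 12 + E / 24 + F / 12 := by
  have h := setIntegral_refTri (h := fun z => A + B * z.1 + C * z.2 + D * z.1 ^ 2
    + E * (z.1 * z.2) + F * z.2 ^ 2) (by fun_prop)
  simp only at h
  rw [h]
  have inner : ∀ s : ℝ, ∫ t in (0 : ℝ)..(1 - s), (A + B * s + C * t + D * s ^ 2 + E * (s * t)
      + F * t ^ 2) = A + C / 2 + F / 3 + (B - A - C + E / 2 - F) * s
        + (D - B + C / 2 - E + F) * s ^ 2 + (E / 2 - D - F / 3) * s ^ 3 := by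
    intro s
    have hd : ∀ t : ℝ, HasDerivAt (fun t => (A + B * s + D * s ^ 2) * t + (C + E * s) * t ^ 2 / 2
        + F * t ^ 3 / 3) (A + B * s + C * t + D * s ^ 2 + E * (s * t) + F * t ^ 2) t := by
      intro t
      have := (((hasDerivAt_id t).const_mul (A + B * s + D * s ^ 2)).add
        ((((hasDerivAt_id t).pow 2).const_mul (C + E * s)).div_const 2)).add
        ((((hasDerivAt_id t).pow 3).const_mul F).div_const 3)
      refine this.congr_deriv ?_
      simp only [id]
      push_cast
      ring
    rw [intervalIntegral.integral_eq_sub_of_hasDerivAt (fun t _ => hd t)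
      (Continuous.intervalIntegrable (by fun_prop) _ _)]
    ring
  simp only [inner]
  have hd : ∀ s : ℝ, HasDerivAt (fun s => (A + C / 2 + F / 3) * s
      + (B - A - C + E / 2 - F) * s ^ 2 / 2 + (D - B + C / 2 - E + F) * s ^ 3 / 3
      + (E / 2 - D - F / 3) * s ^ 4 / 4)
      (A + C / 2 + F / 3 + (B - A - C + E / 2 - F) * s
        + (D - B + C / 2 - E + F) * s ^ 2 + (E / 2 - D - F / 3) * s ^ 3) s := by
    intro s
    have := ((((hasDerivAt_id s).const_mul (A + C / 2 + F / 3)).add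
      ((((hasDerivAt_id s).pow 2).const_mul (B - A - C + E / 2 - F)).div_const 2)).add
      ((((hasDerivAt_id s).pow 3).const_mul (D - B + C / 2 - E + F)).div_const 3)).add
      ((((hasDerivAt_id s).pow 4).const_mul (E / 2 - D - F / 3)).div_const 4)
    refine this.congr_deriv ?_
    simp only [id]
    push_cast
    ring
  rw [intervalIntegral.integral_eq_sub_of_hasDerivAt (fun t _ => hd t)
    (Continuous.intervalIntegrable (by fun_prop) _ _)]
  ring

/-- The linear map with the columns `u` and `v`. -/
def columnMap (u v : Plane) : Plane →L[ℝ] Plane :=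
  (EuclideanSpace.proj 0 : Plane →L[ℝ] ℝ).smulRight u
    + (EuclideanSpace.proj 1 : Plane →L[ℝ] ℝ).smulRight v

theorem columnMap_apply (u v y : Plane) : columnMap u v y = y 0 • u + y 1 • v := rfl

theorem det_columnMap (u v : Plane) : (columnMap u v).det = cross u v := by
  rw [ContinuousLinearMap.det, ← LinearMap.det_toMatrix (EuclideanSpace.basisFun (Fin 2) ℝ).toBasis,
    Matrix.det_fin_two]
  simp [LinearMap.toMatrix_apply, columnMap_apply, cross]
  ring

open Classical in
theorem mem_tri_iff {a b c : Plane} (hab : a ≠ b) (hac : a ≠ c) (hbc : b ≠ c) {x : Plane} :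
    x ∈ tri {a, b, c} ↔ ∃ s t : ℝ, 0 ≤ s ∧ 0 ≤ t ∧ s + t ≤ 1 ∧
      a + (s • (b - a) + t • (c - a)) = x := by
  rw [tri, Finset.mem_convexHull']
  constructor
  · rintro ⟨w, h0, h1, h2⟩
    rw [Finset.sum_insert (by simp [hab, hac]), Finset.sum_pair hbc] at h1 h2
    have ha := h0 a (by simp)
    refine ⟨w b, w c, h0 b (by simp), h0 c (by simp), by linarith, ?_⟩
    rw [← h2, show w a = 1 - w b - w c by linarith]
    module
  · rintro ⟨s, t, hs, ht, hst, rfl⟩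
    refine ⟨fun y => if y = a then 1 - s - t else if y = b then s else t, ?_, ?_, ?_⟩
    · intro y hy
      dsimp only
      split_ifs <;> linarith
    · rw [Finset.sum_insert (by simp [hab, hac]), Finset.sum_pair hbc]
      simp [hab.symm, hac.symm, hbc.symm]
    · rw [Finset.sum_insert (by simp [hab, hac]), Finset.sum_pair hbc]
      simp only [hab.symm, hac.symm, hbc.symm, if_true, if_false]
      module

/-- Cramer's rule with the denominator cleared; dividing by the determinant gives the barycentric
coordinates of `x`. -/
theorem cross_smul_add (a b c x : Plane) :
    cross (b - a) (c - a) • x = cross (b - a) (c - a) • a + (cross (x - a) (c - a) • (b - a)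
      + cross (b - a) (x - a) • (c - a)) := by
  ext i
  fin_cases i <;> simp [cross] <;> ring

open Classical in
theorem tri_eq_image {a b c : Plane} (hab : a ≠ b) (hac : a ≠ c) (hbc : b ≠ c) :
    tri {a, b, c} = (fun y => a + columnMap (b - a) (c - a) y) '' refTri := by
  ext x
  rw [mem_tri_iff hab hac hbc]
  constructor
  · rintro ⟨s, t, hs, ht, hst, rfl⟩
    exact ⟨!₂[s, t], ⟨by simpa using hs, by simpa using ht, by simpa using hst⟩,
      by simp [columnMap_apply]⟩
  · rintro ⟨y, ⟨hs, ht, hst⟩, rfl⟩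
    exact ⟨y 0, y 1, hs, ht, hst, rfl⟩

theorem columnMap_injective {u v : Plane} (h : cross u v ≠ 0) :
    Function.Injective (columnMap u v) := by
  rw [injective_iff_map_eq_zero]
  intro y hy
  rw [columnMap_apply] at hy
  have h0 := congrArg (fun z : Plane => z 0) hy
  have h1 := congrArg (fun z : Plane => z 1) hy
  simp only [PiLp.add_apply, PiLp.smul_apply, smul_eq_mul, PiLp.zero_apply] at h0 h1
  have e0 : cross u v * y 0 = 0 := by
    rw [cross]; linear_combination v 1 * h0 - v 0 * h1
  have e1 : cross u v * y 1 = 0 := by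
    rw [cross]; linear_combination u 0 * h1 - u 1 * h0
  ext i
  fin_cases i
  · simpa [h] using e0
  · simpa [h] using e1

open Classical in
theorem setIntegral_tri {a b c : Plane} (hab : a ≠ b) (hac : a ≠ c) (hbc : b ≠ c)
    (h : cross (b - a) (c - a) ≠ 0) (g : Plane → ℝ) :
    ∫ x in tri {a, b, c}, g x = |cross (b - a) (c - a)| *
      ∫ y in refTri, g (a + (y 0 • (b - a) + y 1 • (c - a))) := by
  rw [tri_eq_image hab hac hbc, integral_image_eq_integral_abs_det_fderiv_smul volume
    isClosed_refTri.measurableSet (f' := fun _ => columnMap (b - a) (c - a))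
    (fun x _ => ((columnMap (b - a) (c - a)).hasFDerivAt.const_add a).hasFDerivWithinAt)
    (fun x _ y _ hxy => columnMap_injective h (add_left_cancel hxy)),
    det_columnMap]
  simp only [smul_eq_mul, integral_const_mul, columnMap_apply]

/-! ### Nondegenerate triangles -/

/-- `K` is the vertex set of a nondegenerate triangle. -/
def IsTriangle (K : Finset Plane) : Prop :=
  K.card = 3 ∧ AffineIndependent ℝ (fun x : K => (x : Plane))

open Classical in
theorem cross_ne_zero_of_affineIndependent {a b c : Plane} (hab : a ≠ b) (hac : a ≠ c)
    (hbc : b ≠ c)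
    (h : AffineIndependent ℝ (fun x : ({a, b, c} : Finset Plane) => (x : Plane))) :
    cross (b - a) (c - a) ≠ 0 := by
  intro h0
  rw [affineIndependent_iff] at h
  have key : ∀ α β γ : ℝ, α + β + γ = 0 → α • a + β • b + γ • c = 0 → β = 0 := by
    intro α β γ h1 h2
    set w : Plane → ℝ := fun y => if y = a then α else if y = b then β else γ
    have := h Finset.univ (fun e => w e) ?_ ?_ ⟨b, by simp⟩ (Finset.mem_univ _)
    · simpa [w, hab.symm] using this
    · rw [Finset.sum_coe_sort ({a, b, c} : Finset Plane) w,
        Finset.sum_insert (by simp [hab, hac]), Finset.sum_pair hbc]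
      simpa [w, hab.symm, hac.symm, hbc.symm, add_assoc] using h1
    · rw [Finset.sum_coe_sort ({a, b, c} : Finset Plane) (fun y => w y • y),
        Finset.sum_insert (by simp [hab, hac]), Finset.sum_pair hbc]
      simpa [w, hab.symm, hac.symm, hbc.symm, add_assoc] using h2
  have h0' : (b 0 - a 0) * (c 1 - a 1) - (b 1 - a 1) * (c 0 - a 0) = 0 := by
    simpa [cross] using h0
  -- With `u = b - a` and `v = c - a`, the relation `v₀ u - u₀ v` has first coordinate zero and
  -- second coordinate minus the determinant, so it vanishes and `v₀ = 0`. Below, `v₁ u - u₁ v` does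
  -- the same for `v₁`, and `v = 0` contradicts `a ≠ c`.
  have k0 : c 0 - a 0 = 0 := by
    refine key ((b 0 - a 0) - (c 0 - a 0)) (c 0 - a 0) (-(b 0 - a 0)) (by ring) ?_
    ext i
    fin_cases i
    · simp; ring
    · simp; linear_combination -h0'
  have k1 : c 1 - a 1 = 0 := by
    refine key ((b 1 - a 1) - (c 1 - a 1)) (c 1 - a 1) (-(b 1 - a 1)) (by ring) ?_
    ext i
    fin_cases i
    · simp; linear_combination h0'
    · simp; ring
  refine hac ?_
  ext i
  fin_cases i
  · simpa using (sub_eq_zero.1 k0).symm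
  · simpa using (sub_eq_zero.1 k1).symm

open Classical in
theorem IsTriangle.exists_eq_of_mem {K : Finset Plane} (hK : IsTriangle K) {a b : Plane}
    (hab : a ≠ b) (ha : a ∈ K) (hb : b ∈ K) :
    ∃ c, a ≠ c ∧ b ≠ c ∧ K = {a, b, c} ∧ cross (b - a) (c - a) ≠ 0 := by
  obtain ⟨hcard, haff⟩ := hK
  have h1 : ((K.erase a).erase b).card = 1 := by
    rw [Finset.card_erase_of_mem (Finset.mem_erase.2 ⟨hab.symm, hb⟩),
      Finset.card_erase_of_mem ha, hcard]
  obtain ⟨c, hc⟩ := Finset.card_eq_one.1 h1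
  have hc' : c ∈ (K.erase a).erase b := by simp [hc]
  simp only [Finset.mem_erase] at hc'
  have hKeq : K = {a, b, c} := by
    rw [← Finset.insert_erase ha, ← Finset.insert_erase (Finset.mem_erase.2 ⟨hab.symm, hb⟩), hc]
  refine ⟨c, hc'.2.1.symm, hc'.1.symm, hKeq, ?_⟩
  subst hKeq
  exact cross_ne_zero_of_affineIndependent hab hc'.2.1.symm hc'.1.symm haff

open Classical in
theorem IsTriangle.exists_eq {K : Finset Plane} (hK : IsTriangle K) :
    ∃ a b c, a ≠ b ∧ a ≠ c ∧ b ≠ c ∧ K = {a, b, c} ∧ cross (b - a) (c - a) ≠ 0 := by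
  obtain ⟨a, b, c, hab, -, -, h⟩ := Finset.card_eq_three.1 hK.1
  obtain ⟨c, h1, h2, h3, h4⟩ := hK.exists_eq_of_mem hab (by simp [h]) (by simp [h])
  exact ⟨a, b, c, hab, h1, h2, h3, h4⟩

open Classical in
theorem sum_triple {M : Type*} [AddCommMonoid M] {a b c : Plane} (hab : a ≠ b) (hac : a ≠ c)
    (hbc : b ≠ c) (g : Plane → M) :
    ∑ v ∈ ({a, b, c} : Finset Plane), g v = g a + (g b + g c) := by
  rw [Finset.sum_insert (by simp [hab, hac]), Finset.sum_pair hbc]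

open Classical in
theorem volume_real_tri {a b c : Plane} (hab : a ≠ b) (hac : a ≠ c) (hbc : b ≠ c)
    (h : cross (b - a) (c - a) ≠ 0) :
    volume.real (tri {a, b, c}) = |cross (b - a) (c - a)| / 2 := by
  have h1 := setIntegral_tri hab hac hbc h (fun _ => 1)
  have h2 := setIntegral_refTri_quadratic 1 0 0 0 0 0
  simp only [zero_mul, add_zero, zero_div] at h2
  rw [h2, setIntegral_const, smul_eq_mul, mul_one] at h1
  rw [h1]
  ring

theorem IsTriangle.volume_real_pos {K : Finset Plane} (hK : IsTriangle K) :
    0 < volume.real (tri K) := by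
  classical
  obtain ⟨a, b, c, hab, hac, hbc, rfl, h⟩ := hK.exists_eq
  rw [volume_real_tri hab hac hbc h]
  positivity

/-! ### Quadratics and Raviart–Thomas fields centred at the barycenter -/

/-- The mean of `|x - x^G|²` over the triangle `K`. -/
def secondMoment (K : Finset Plane) : ℝ := 1 / 12 * ∑ v ∈ K, ‖v - bary K‖ ^ 2

/-- The quadratic functions `c + ⟨g, x - x^G⟩ + s/2 |x - x^G|²`. -/
def quad (K : Finset Plane) (c : ℝ) (g : Plane) (s : ℝ) (x : Plane) : ℝ :=
  c + inner ℝ g (x - bary K) + s / 2 * ‖x - bary K‖ ^ 2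

/-- The Raviart–Thomas fields `g + s (x - x^G)`. -/
def rt (K : Finset Plane) (g : Plane) (s : ℝ) (x : Plane) : Plane := g + s • (x - bary K)

theorem inner_eq (x y : Plane) : inner ℝ x y = x 0 * y 0 + x 1 * y 1 := by
  rw [PiLp.inner_apply, Fin.sum_univ_two]
  simp [mul_comm]

theorem normSq_eq (x : Plane) : ‖x‖ ^ 2 = x 0 ^ 2 + x 1 ^ 2 := by
  rw [EuclideanSpace.real_norm_sq_eq, Fin.sum_univ_two]

theorem IsTriangle.setIntegral_quad {K : Finset Plane} (hK : IsTriangle K) (c : ℝ) (g : Plane)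
    (s : ℝ) :
    ∫ x in tri K, quad K c g s x = volume.real (tri K) * (c + s / 2 * secondMoment K) := by
  classical
  obtain ⟨a, b, d, hab, had, hbd, rfl, h⟩ := hK.exists_eq
  rw [volume_real_tri hab had hbd h, setIntegral_tri hab had hbd h, secondMoment, bary,
    sum_triple hab had hbd, sum_triple hab had hbd]
  set u := b - a with hu
  set v := d - a with hv
  have hb : b = a + u := by rw [hu]; abel
  have hd : d = a + v := by rw [hv]; abel
  -- In reference coordinates the barycenter is `a + (u + v) / 3`; expanding about it produces these
  -- coefficients.
  have key : ∀ y : Plane, quad {a, b, d} c g s (a + (y 0 • u + y 1 • v)) =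
      (c - (g 0 * (u 0 + v 0) + g 1 * (u 1 + v 1)) / 3
          + s / 18 * ((u 0 + v 0) ^ 2 + (u 1 + v 1) ^ 2))
        + (g 0 * u 0 + g 1 * u 1 - s / 3 * ((u 0 + v 0) * u 0 + (u 1 + v 1) * u 1)) * y 0
        + (g 0 * v 0 + g 1 * v 1 - s / 3 * ((u 0 + v 0) * v 0 + (u 1 + v 1) * v 1)) * y 1
        + s / 2 * (u 0 ^ 2 + u 1 ^ 2) * y 0 ^ 2 + s * (u 0 * v 0 + u 1 * v 1) * (y 0 * y 1)
        + s / 2 * (v 0 ^ 2 + v 1 ^ 2) * y 1 ^ 2 := by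
    intro y
    rw [quad, bary, sum_triple hab had hbd, inner_eq, normSq_eq, hb, hd]
    simp only [PiLp.sub_apply, PiLp.add_apply, PiLp.smul_apply, smul_eq_mul]
    ring
  simp only [key]
  rw [setIntegral_refTri_quadratic, normSq_eq, normSq_eq, normSq_eq, hb, hd]
  simp only [PiLp.sub_apply, PiLp.add_apply, PiLp.smul_apply, smul_eq_mul]
  ring

theorem inner_rt_rt (K : Finset Plane) (g h : Plane) (s t : ℝ) (x : Plane) :
    inner ℝ (rt K g s x) (rt K h t x)
      = quad K (inner ℝ g h) (t • g + s • h) (2 * s * t) x := by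
  simp only [rt, quad, inner_eq, normSq_eq, PiLp.sub_apply, PiLp.add_apply, PiLp.smul_apply,
    smul_eq_mul]
  ring

theorem IsTriangle.setIntegral_inner_rt {K : Finset Plane} (hK : IsTriangle K) (g h : Plane)
    (s t : ℝ) :
    ∫ x in tri K, inner ℝ (rt K g s x) (rt K h t x)
      = volume.real (tri K) * (inner ℝ g h + s * t * secondMoment K) := by
  simp only [inner_rt_rt, hK.setIntegral_quad]
  ring

theorem secondMoment_pos {K : Finset Plane} (hK : IsTriangle K) : 0 < secondMoment K := by
  classical
  obtain ⟨a, b, hab, ha, hb⟩ : ∃ a b, a ≠ b ∧ a ∈ K ∧ b ∈ K := by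
    obtain ⟨a, b, c, hab, -, -, rfl, -⟩ := hK.exists_eq
    exact ⟨a, b, hab, by simp, by simp⟩
  refine mul_pos (by norm_num) ((Finset.sum_nonneg fun v _ => sq_nonneg _).lt_of_ne' fun h => ?_)
  have h' := (Finset.sum_eq_zero_iff_of_nonneg fun v _ => sq_nonneg _).1 h
  have e : ∀ v ∈ K, v = bary K := fun v hv => by simpa [sub_eq_zero] using h' v hv
  exact hab ((e a ha).trans (e b hb).symm)

theorem bubble_eq_quad (K : Finset Plane) : bubble K = quad K (-secondMoment K) 0 1 := by
  ext x
  simp only [bubble, quad, secondMoment, inner_zero_left]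
  ring

theorem gradient_quad (K : Finset Plane) (c : ℝ) (g : Plane) (s : ℝ) :
    gradient (quad K c g s) = rt K g s := by
  ext1 x
  refine HasGradientAt.gradient ?_
  rw [hasGradientAt_iff_hasFDerivAt]
  have h0 : HasFDerivAt (fun x : Plane => x - bary K) (ContinuousLinearMap.id ℝ Plane) x :=
    (hasFDerivAt_id x).sub_const _
  have h1 := (((innerSL ℝ g).hasFDerivAt (x := x - bary K)).comp x h0).const_add c
  have h2 := (h0.norm_sq).const_mul (s / 2)
  refine (h1.add h2).congr_fderiv ?_
  ext y
  simp [rt]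
  ring

theorem divergence_rt (K : Finset Plane) (g : Plane) (s : ℝ) (x : Plane) :
    divergence (rt K g s) x = 2 * s := by
  have h : HasFDerivAt (rt K g s) (s • ContinuousLinearMap.id ℝ Plane) x :=
    (((hasFDerivAt_id x).sub_const (bary K)).const_smul s).const_add g
  rw [divergence, h.fderiv, Fin.sum_univ_two]
  simp
  ring

/-! ### A triangle near one of its edges -/

theorem isLinearMap_cross (w : Plane) : IsLinearMap ℝ (cross w) where
  map_add x y := by simp only [cross, PiLp.add_apply]; ring
  map_smul r x := by simp only [cross, PiLp.smul_apply, smul_eq_mul]; ring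

theorem continuous_cross_left (w : Plane) : Continuous (cross w) := by
  unfold cross; fun_prop

theorem continuous_cross_right (w : Plane) : Continuous fun x => cross x w := by
  unfold cross; fun_prop

theorem midpoint_apply (a b : Plane) (i : Fin 2) : midpoint ℝ a b i = (a i + b i) / 2 := by
  rw [midpoint_eq_smul_add]
  simp
  ring

/-- The position of the barycenter of `K` relative to the oriented line through `a` and `b`. -/
def side (K : Finset Plane) (a b : Plane) : ℝ := cross (b - a) (bary K - a)

open Classical in
theorem side_eq {a b c : Plane} (hab : a ≠ b) (hac : a ≠ c) (hbc : b ≠ c) :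
    side {a, b, c} a b = cross (b - a) (c - a) / 3 := by
  rw [side, bary, sum_triple hab hac hbc]
  simp only [cross, PiLp.sub_apply, PiLp.add_apply, PiLp.smul_apply, smul_eq_mul]
  ring

theorem IsTriangle.side_ne_zero {K : Finset Plane} (hK : IsTriangle K) {a b : Plane}
    (hab : a ≠ b) (ha : a ∈ K) (hb : b ∈ K) : side K a b ≠ 0 := by
  classical
  obtain ⟨c, hac, hbc, rfl, h⟩ := hK.exists_eq_of_mem hab ha hb
  rw [side_eq hab hac hbc]
  exact div_ne_zero h (by norm_num)

theorem IsTriangle.cross_mul_side_nonneg {K : Finset Plane} (hK : IsTriangle K) {a b : Plane}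
    (hab : a ≠ b) (ha : a ∈ K) (hb : b ∈ K) {x : Plane} (hx : x ∈ tri K) :
    0 ≤ cross (b - a) (x - a) * side K a b := by
  classical
  obtain ⟨c, hac, hbc, rfl, h⟩ := hK.exists_eq_of_mem hab ha hb
  rw [side_eq hab hac hbc]
  obtain ⟨s, t, hs, ht, hst, rfl⟩ := (mem_tri_iff hab hac hbc).1 hx
  have : cross (b - a) (a + (s • (b - a) + t • (c - a)) - a) = t * cross (b - a) (c - a) := by
    simp only [cross, PiLp.sub_apply, PiLp.add_apply, PiLp.smul_apply, smul_eq_mul]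
    ring
  rw [this]
  nlinarith [mul_nonneg ht (mul_self_nonneg (cross (b - a) (c - a)))]

/-- Near the midpoint of an edge a triangle coincides with a half-plane. -/
theorem IsTriangle.eventually_mem_tri {K : Finset Plane} (hK : IsTriangle K) {a b : Plane}
    (hab : a ≠ b) (ha : a ∈ K) (hb : b ∈ K) :
    ∀ᶠ x in 𝓝 (midpoint ℝ a b), 0 ≤ cross (b - a) (x - a) * side K a b → x ∈ tri K := by
  classical
  obtain ⟨c, hac, hbc, rfl, h⟩ := hK.exists_eq_of_mem hab ha hb
  rw [side_eq hab hac hbc]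
  set D := cross (b - a) (c - a) with hD
  -- The two quotients are the barycentric coordinates of `x` at `b` and at `c`, with values 1/2 and
  -- 0 at the midpoint. The coordinates at `a` and `b` stay positive nearby, so only the sign of the
  -- one at `c` matters: that is the half-plane condition.
  have hc1 : Continuous fun x : Plane => cross (x - a) (c - a) / D :=
    ((continuous_cross_right (c - a)).comp (continuous_id.sub continuous_const)).div_const _
  have hc2 : Continuous fun x : Plane => cross (x - a) (c - a) / D + cross (b - a) (x - a) / D :=
    hc1.add (((continuous_cross_left (b - a)).comp (continuous_id.sub continuous_const)).div_const _)
  have m1 : cross (midpoint ℝ a b - a) (c - a) = D / 2 := by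
    simp only [hD, cross, PiLp.sub_apply, midpoint_apply]; ring
  have m2 : cross (b - a) (midpoint ℝ a b - a) = 0 := by
    simp only [cross, PiLp.sub_apply, midpoint_apply]; ring
  have e1 : ∀ᶠ x in 𝓝 (midpoint ℝ a b), 0 < cross (x - a) (c - a) / D :=
    hc1.continuousAt.eventually_const_lt (by beta_reduce; rw [m1]; field_simp; norm_num)
  have e2 : ∀ᶠ x in 𝓝 (midpoint ℝ a b),
      cross (x - a) (c - a) / D + cross (b - a) (x - a) / D < 1 :=
    hc2.continuousAt.eventually_lt_const (by
      beta_reduce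
      rw [m1, m2, zero_div, add_zero, div_div_cancel_left' h]
      norm_num)
  filter_upwards [e1, e2] with x h1 h2 h3
  refine (mem_tri_iff hab hac hbc).2 ⟨cross (x - a) (c - a) / D, cross (b - a) (x - a) / D, h1.le,
    ?_, h2.le, ?_⟩
  · have : cross (b - a) (x - a) / D = 3 * (cross (b - a) (x - a) * (D / 3)) / D ^ 2 := by
      field_simp
    rw [this]
    positivity
  · have h4 := cross_smul_add a b c x
    rw [← hD] at h4
    have h5 := congrArg (fun z => D⁻¹ • z) h4
    simp only [smul_add, smul_smul, inv_mul_cancel₀ h, one_smul] at h5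
    rw [div_eq_inv_mul, div_eq_inv_mul]
    exact h5.symm

theorem frequently_cross_mul_pos {a b : Plane} (hab : a ≠ b) {r : ℝ} (hr : r ≠ 0) :
    ∃ᶠ x in 𝓝 (midpoint ℝ a b), 0 < cross (b - a) (x - a) * r := by
  -- `J` is `b - a` turned by a right angle; moving from the midpoint along `r • J` reaches the
  -- required side.
  set J : Plane := !₂[-(b 1 - a 1), b 0 - a 0] with hJ
  have hpos : 0 < (b 0 - a 0) ^ 2 + (b 1 - a 1) ^ 2 := by
    have : 0 < ‖b - a‖ ^ 2 := by
      have : b - a ≠ 0 := sub_ne_zero.2 hab.symm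
      positivity
    simpa [normSq_eq] using this
  have ht : Tendsto (fun ε : ℝ => midpoint ℝ a b + (ε * r) • J) (𝓝[>] 0) (𝓝 (midpoint ℝ a b)) := by
    have : Continuous fun ε : ℝ => midpoint ℝ a b + (ε * r) • J := by fun_prop
    have h := this.tendsto 0
    simp only [zero_mul, zero_smul, add_zero] at h
    exact h.mono_left nhdsWithin_le_nhds
  refine ht.frequently (Eventually.frequently ?_)
  filter_upwards [self_mem_nhdsWithin] with ε hε
  have hε' : (0 : ℝ) < ε := hε
  have : cross (b - a) (midpoint ℝ a b + (ε * r) • J - a) * r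
      = ε * r ^ 2 * ((b 0 - a 0) ^ 2 + (b 1 - a 1) ^ 2) := by
    simp [cross, midpoint_apply, hJ]
    ring
  rw [this]
  positivity

theorem midpoint_mem_tri {K : Finset Plane} {a b : Plane} (ha : a ∈ K) (hb : b ∈ K) :
    midpoint ℝ a b ∈ tri K :=
  (convex_convexHull ℝ (K : Set Plane)).midpoint_mem (subset_convexHull ℝ _ ha)
    (subset_convexHull ℝ _ hb)

theorem isClosed_tri (K : Finset Plane) : IsClosed (tri K) :=
  (K.finite_toSet.isCompact_convexHull ℝ).isClosed

/-- Without `a`, the remaining vertices span at most the line through `b` and `c`, which misses the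
midpoint of `a` and `b`. -/
theorem IsTriangle.mem_of_midpoint_mem {K : Finset Plane} (hK : IsTriangle K) {a b : Plane}
    (hab : a ≠ b) (ha : a ∈ K) (hb : b ∈ K) {S : Set Plane}
    (h : midpoint ℝ a b ∈ convexHull ℝ ((K : Set Plane) ∩ S)) : a ∈ S := by
  classical
  obtain ⟨c, hac, hbc, rfl, hD⟩ := hK.exists_eq_of_mem hab ha hb
  by_contra haS
  have hsub : ((({a, b, c} : Finset Plane) : Set Plane) ∩ S) ⊆
      {y | cross (c - b) y = cross (c - b) b} := by
    rintro y ⟨hy, hyS⟩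
    simp only [Finset.coe_insert, Finset.coe_singleton, Set.mem_insert_iff,
      Set.mem_singleton_iff] at hy
    rcases hy with rfl | rfl | rfl
    · exact absurd hyS haS
    · rfl
    · simp only [Set.mem_ofPred_eq, cross, PiLp.sub_apply]; ring
  have hm := convexHull_min hsub (convex_hyperplane (isLinearMap_cross (c - b)) _) h
  simp only [Set.mem_ofPred_eq, cross, PiLp.sub_apply, midpoint_apply] at hm
  apply hD
  simp only [cross, PiLp.sub_apply]
  linear_combination 2 * hm

theorem IsConvexPolygonalDomain.interior_closure {Ω : Set Plane} (hΩ : IsConvexPolygonalDomain Ω) :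
    interior (closure Ω) = Ω := by
  rw [hΩ.convex.interior_closure_eq_interior_of_nonempty_interior
    (by rw [hΩ.isOpen.interior_eq]; exact hΩ.nonempty), hΩ.isOpen.interior_eq]

/-- The triangles only describe `closure Ω`. Convexity excludes slits, so the boundary can be read
off from the closure. -/
theorem IsConvexPolygonalDomain.mem_frontier_iff {Ω : Set Plane} (hΩ : IsConvexPolygonalDomain Ω)
    {x : Plane} : x ∈ frontier Ω ↔ x ∈ closure Ω ∧ ¬ ∀ᶠ y in 𝓝 x, y ∈ closure Ω := by
  rw [frontier, Set.mem_sdiff, hΩ.isOpen.interior_eq]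
  nth_rw 2 [← hΩ.interior_closure]
  rw [mem_interior_iff_mem_nhds]
  rfl

/-! ### Adjacency of triangles across an edge -/

namespace Triangulation

variable {Ω : Set Plane} (T : Triangulation Ω)

theorem isTriangle (K : T.elems) : IsTriangle K.1 := ⟨T.card_eq K K.2, T.affineIndependent K K.2⟩

theorem tri_subset (K : T.elems) : tri K.1 ⊆ closure Ω := by
  rw [← T.cover]
  exact Set.subset_biUnion_of_mem (u := fun K : Finset Plane => convexHull ℝ (K : Set Plane)) K.2

/-- Two triangles with a common edge lie on opposite sides of it. -/
theorem side_mul_side_neg {K L : T.elems} (hKL : K ≠ L) {a b : Plane} (hab : a ≠ b)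
    (haK : a ∈ K.1) (hbK : b ∈ K.1) (haL : a ∈ L.1) (hbL : b ∈ L.1) :
    side K a b * side L a b < 0 := by
  classical
  by_contra hcon
  have h1 := (T.isTriangle K).side_ne_zero hab haK hbK
  have h2 := (T.isTriangle L).side_ne_zero hab haL hbL
  have hpos : 0 < side K a b * side L a b :=
    (not_lt.1 hcon).lt_of_ne' (mul_ne_zero h1 h2)
  -- If both triangles lay on the same side, some point off the line `ab` near the midpoint would
  -- belong to both.
  obtain ⟨x, hx, hxK, hxL⟩ := ((frequently_cross_mul_pos hab h1).and_eventually
    (((T.isTriangle K).eventually_mem_tri hab haK hbK).and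
      ((T.isTriangle L).eventually_mem_tri hab haL hbL))).exists
  have hxL' : x ∈ tri L.1 := by
    refine hxL (le_of_lt ?_)
    have : 0 < (cross (b - a) (x - a) * side L a b) * side K a b ^ 2 := by
      have := mul_pos hx hpos
      linarith [this]
    exact pos_of_mul_pos_left this (sq_nonneg _)
  have hx2 : x ∈ convexHull ℝ ((K.1 : Set Plane) ∩ (L.1 : Set Plane)) := by
    rw [← T.inter_eq K K.2 L L.2]
    exact ⟨hxK hx.le, hxL'⟩
  -- The third vertices differ because the triangles do. So all common vertices, and with them the
  -- intersection, lie on the line `ab`.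
  obtain ⟨c, hac, hbc, hKeq, -⟩ := (T.isTriangle K).exists_eq_of_mem hab haK hbK
  obtain ⟨d, had, hbd, hLeq, -⟩ := (T.isTriangle L).exists_eq_of_mem hab haL hbL
  have hsub : ((K.1 : Set Plane) ∩ (L.1 : Set Plane)) ⊆
      {y | cross (b - a) y = cross (b - a) a} := by
    rintro y ⟨hyK, hyL⟩
    rw [Finset.mem_coe, hKeq] at hyK
    rw [Finset.mem_coe, hLeq] at hyL
    simp only [Finset.mem_insert, Finset.mem_singleton] at hyK hyL
    rcases hyK with rfl | rfl | rfl
    · rfl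
    · simp only [Set.mem_ofPred_eq, cross, PiLp.sub_apply]; ring
    · rcases hyL with h | h | h
      · exact absurd h.symm hac
      · exact absurd h.symm hbc
      · exact absurd (Subtype.ext (by rw [hKeq, hLeq, h])) hKL
  have hm := convexHull_min hsub (convex_hyperplane (isLinearMap_cross (b - a)) _) hx2
  have : cross (b - a) (x - a) = 0 := by
    rw [(isLinearMap_cross (b - a)).map_sub, hm, sub_self]
  rw [this, zero_mul] at hx
  exact lt_irrefl _ hx

/-- The triangles occupy opposite half-planes near the midpoint and together cover a neighbourhood
of it. -/
theorem midpoint_notMem_frontier (hΩ : IsConvexPolygonalDomain Ω) {K L : T.elems} (hKL : K ≠ L)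
    {a b : Plane} (hab : a ≠ b) (haK : a ∈ K.1) (hbK : b ∈ K.1) (haL : a ∈ L.1) (hbL : b ∈ L.1) :
    midpoint ℝ a b ∉ frontier Ω := by
  rw [hΩ.mem_frontier_iff]
  rintro ⟨-, h⟩
  apply h
  have hneg := T.side_mul_side_neg hKL hab haK hbK haL hbL
  filter_upwards [(T.isTriangle K).eventually_mem_tri hab haK hbK,
    (T.isTriangle L).eventually_mem_tri hab haL hbL] with x h1 h2
  by_cases hx : 0 ≤ cross (b - a) (x - a) * side K a b
  · exact T.tri_subset K (h1 hx)
  · refine T.tri_subset L (h2 ?_)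
    by_contra h3
    nlinarith [mul_pos_of_neg_of_neg (not_le.1 hx) (not_le.1 h3),
      mul_nonneg (sq_nonneg (cross (b - a) (x - a))) (neg_nonneg.2 hneg.le)]

/-- An edge whose midpoint is not on the boundary belongs to a second triangle. -/
theorem exists_neighbor (hΩ : IsConvexPolygonalDomain Ω) (K : T.elems) {a b : Plane} (hab : a ≠ b)
    (ha : a ∈ K.1) (hb : b ∈ K.1) (hm : midpoint ℝ a b ∉ frontier Ω) :
    ∃ L : T.elems, L ≠ K ∧ a ∈ L.1 ∧ b ∈ L.1 := by
  have hmK := midpoint_mem_tri ha hb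
  have hev : ∀ᶠ y in 𝓝 (midpoint ℝ a b), y ∈ closure Ω := by
    rw [hΩ.mem_frontier_iff] at hm
    by_contra h
    exact hm ⟨T.tri_subset K hmK, h⟩
  have hs := (T.isTriangle K).side_ne_zero hab ha hb
  -- Points just across the edge are covered by triangles other than `K`. As there are finitely
  -- many, one closed triangle is met arbitrarily near the midpoint and contains it; conformity then
  -- makes `a` and `b` its vertices.
  have hfr : ∃ᶠ y in 𝓝 (midpoint ℝ a b), ∃ L : T.elems, L ≠ K ∧ y ∈ tri L.1 := by
    refine ((frequently_cross_mul_pos hab (neg_ne_zero.2 hs)).and_eventually hev).mono ?_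
    rintro y ⟨h1, h2⟩
    rw [← T.cover] at h2
    simp only [Set.mem_iUnion] at h2
    obtain ⟨L, hL, hy⟩ := h2
    refine ⟨⟨L, hL⟩, ?_, hy⟩
    rintro rfl
    have := (T.isTriangle ⟨L, hL⟩).cross_mul_side_nonneg hab ha hb hy
    linarith
  rw [frequently_exists] at hfr
  obtain ⟨L, hL⟩ := hfr
  obtain ⟨-, hLK, -⟩ := hL.exists
  have hmL : midpoint ℝ a b ∈ tri L.1 :=
    (isClosed_tri L.1).mem_of_frequently_of_tendsto (hL.mono fun _ h => h.2) tendsto_id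
  have hI : midpoint ℝ a b ∈ convexHull ℝ ((K.1 : Set Plane) ∩ (L.1 : Set Plane)) := by
    rw [← T.inter_eq K K.2 L L.2]
    exact ⟨hmK, hmL⟩
  exact ⟨L, hLK, (T.isTriangle K).mem_of_midpoint_mem hab ha hb hI,
    (T.isTriangle K).mem_of_midpoint_mem hab.symm hb ha (by rwa [midpoint_comm])⟩

end Triangulation

/-! ### Normal forms and Green's formula -/

theorem quad_add (K : Finset Plane) (c d : ℝ) (g h : Plane) (s t : ℝ) :
    quad K c g s + quad K d h t = quad K (c + d) (g + h) (s + t) := by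
  ext x
  simp only [quad, Pi.add_apply, inner_add_left]
  ring

theorem smul_quad (K : Finset Plane) (r c : ℝ) (g : Plane) (s : ℝ) :
    r • quad K c g s = quad K (r * c) (r • g) (r * s) := by
  ext x
  simp only [quad, Pi.smul_apply, inner_smul_left, smul_eq_mul, conj_trivial]
  ring

@[simp]
theorem quad_bary (K : Finset Plane) (c : ℝ) (g : Plane) (s : ℝ) : quad K c g s (bary K) = c := by
  simp [quad]

@[simp]
theorem quad_zero_zero (K : Finset Plane) (c : ℝ) (x : Plane) : quad K c 0 0 x = c := by
  simp [quad]

theorem exists_quad_of_affine (K : Finset Plane) (a : Plane →ᵃ[ℝ] ℝ) :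
    ∃ c g, ⇑a = quad K c g 0 := by
  refine ⟨a (bary K), (InnerProductSpace.toDual ℝ Plane).symm
    (LinearMap.toContinuousLinearMap a.linear), funext fun x => ?_⟩
  rw [quad, InnerProductSpace.toDual_symm_apply]
  have := a.linearMap_vsub x (bary K)
  simp only [vsub_eq_sub] at this
  simp [this]

theorem exists_affine_of_quad (K : Finset Plane) (c : ℝ) (g : Plane) :
    ∃ a : Plane →ᵃ[ℝ] ℝ, ∀ x, quad K c g 0 x = a x := by
  refine ⟨(innerSL ℝ g).toLinearMap.toAffineMap
    + AffineMap.const ℝ Plane (c - inner ℝ g (bary K)), fun x => ?_⟩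
  simp [quad, inner_sub_right]
  ring

theorem exists_rt (K : Finset Plane) (a : Plane) (c : ℝ) :
    ∃ h d, (fun x => a + c • x) = rt K h d :=
  ⟨a + c • bary K, c, funext fun x => by simp only [rt]; module⟩

/-- Green's formula on a triangle in terms of the midpoint values and the normal fluxes. -/
theorem IsTriangle.green {K : Finset Plane} (hK : IsTriangle K) (c : ℝ) (g h : Plane) (d : ℝ) :
    2 * (volume.real (tri K) * (inner ℝ g h + 2 * d * c)) =
      ∑ a ∈ K, ∑ b ∈ K, -Real.sign (side K a b) *
        (quad K c g 0 (midpoint ℝ a b) * cross (b - a) (rt K h d (midpoint ℝ a b))) := by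
  classical
  obtain ⟨x, y, z, hxy, hxz, hyz, rfl, hD⟩ := hK.exists_eq
  have sub_self_cross : ∀ v w : Plane, cross (v - v) w = 0 := fun v w => by simp [cross]
  simp only [sum_triple hxy hxz hyz, sub_self_cross, mul_zero, zero_add, add_zero]
  rw [volume_real_tri hxy hxz hyz hD]
  set D := cross (y - x) (z - x) with hDdef
  have s1 : side {x, y, z} x y = D / 3 := side_eq hxy hxz hyz
  have s2 : side {x, y, z} y x = -(D / 3) := by
    rw [side, bary, sum_triple hxy hxz hyz, hDdef]
    simp only [cross, PiLp.sub_apply, PiLp.add_apply, PiLp.smul_apply, smul_eq_mul]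
    ring
  have s3 : side {x, y, z} y z = D / 3 := by
    rw [side, bary, sum_triple hxy hxz hyz, hDdef]
    simp only [cross, PiLp.sub_apply, PiLp.add_apply, PiLp.smul_apply, smul_eq_mul]
    ring
  have s4 : side {x, y, z} z y = -(D / 3) := by
    rw [side, bary, sum_triple hxy hxz hyz, hDdef]
    simp only [cross, PiLp.sub_apply, PiLp.add_apply, PiLp.smul_apply, smul_eq_mul]
    ring
  have s5 : side {x, y, z} z x = D / 3 := by
    rw [side, bary, sum_triple hxy hxz hyz, hDdef]
    simp only [cross, PiLp.sub_apply, PiLp.add_apply, PiLp.smul_apply, smul_eq_mul]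
    ring
  have s6 : side {x, y, z} x z = -(D / 3) := by
    rw [side, bary, sum_triple hxy hxz hyz, hDdef]
    simp only [cross, PiLp.sub_apply, PiLp.add_apply, PiLp.smul_apply, smul_eq_mul]
    ring
  rw [s1, s2, s3, s4, s5, s6]
  -- One orientation of each edge suffices: reversing it changes the sign of both `side` and the
  -- cross product, so the two ordered pairs contribute equally.
  have key : D * (inner ℝ g h + 2 * d * c) = -2 *
      (quad {x, y, z} c g 0 (midpoint ℝ x y) * cross (y - x) (rt {x, y, z} h d (midpoint ℝ x y))
      + quad {x, y, z} c g 0 (midpoint ℝ y z) * cross (z - y) (rt {x, y, z} h d (midpoint ℝ y z))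
      + quad {x, y, z} c g 0 (midpoint ℝ z x) *
        cross (x - z) (rt {x, y, z} h d (midpoint ℝ z x))) := by
    simp only [quad, rt, bary, sum_triple hxy hxz hyz, hDdef, inner_eq, cross, PiLp.sub_apply,
      PiLp.add_apply, PiLp.smul_apply, smul_eq_mul, midpoint_apply]
    ring
  have flip : ∀ a b w : Plane, cross (a - b) w = -cross (b - a) w := fun a b w => by
    simp only [cross, PiLp.sub_apply]; ring
  rw [midpoint_comm (R := ℝ) y x, midpoint_comm (R := ℝ) z y, midpoint_comm (R := ℝ) x z,
    flip x y, flip y z, flip z x]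
  rw [Real.sign_neg]
  rcases hD.lt_or_gt with h0 | h0
  · rw [Real.sign_of_neg (by linarith), abs_of_neg h0]
    linear_combination -key
  · rw [Real.sign_of_pos (by linarith), abs_of_pos h0]
    linear_combination key

namespace Triangulation

variable {Ω : Set Plane} (T : Triangulation Ω)

theorem exists_quad_of_mem_V {v : T.BrokenFun} (hv : v ∈ T.V) :
    ∃ (c : T.elems → ℝ) (g : T.elems → Plane), v = fun K : T.elems => quad K (c K) (g K) 0 := by
  have : ∀ K, ∃ (c : ℝ) (g : Plane), v K = quad K c g 0 := fun K => by
    obtain ⟨a, ha⟩ := hv.1 K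
    obtain ⟨c, g, h⟩ := exists_quad_of_affine K a
    exact ⟨c, g, (funext ha).trans h⟩
  choose c g h using this
  exact ⟨c, g, funext h⟩

theorem exists_rt_of_mem_W {q : T.BrokenField} (hq : q ∈ T.W) :
    ∃ (h : T.elems → Plane) (d : T.elems → ℝ), q = fun K : T.elems => rt K (h K) (d K) := by
  have : ∀ K, ∃ (h : Plane) (d : ℝ), q K = rt K h d := fun K => by
    obtain ⟨a, c, ha⟩ := hq.1 K
    obtain ⟨h, d, e⟩ := exists_rt K a c
    exact ⟨h, d, (funext ha).trans e⟩
  choose h d e using this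
  exact ⟨h, d, funext e⟩

/-- An edge lies in at most two triangles, since three cannot be pairwise on opposite sides of it.
-/
theorem sum_eq_add_of_common_edge {K L : T.elems} (hKL : K ≠ L) {a b : Plane} (hab : a ≠ b)
    (haK : a ∈ K.1) (hbK : b ∈ K.1) (haL : a ∈ L.1) (hbL : b ∈ L.1) (F : T.elems → ℝ)
    (hF : ∀ M, ¬(a ∈ M.1 ∧ b ∈ M.1) → F M = 0) : ∑ M, F M = F K + F L := by
  refine Fintype.sum_eq_add K L hKL fun M hM => hF M ?_
  rintro ⟨ha, hb⟩
  have h1 := T.side_mul_side_neg hKL hab haK hbK haL hbL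
  have h2 := T.side_mul_side_neg hM.1 hab ha hb haK hbK
  have h3 := T.side_mul_side_neg hM.2 hab ha hb haL hbL
  nlinarith [mul_pos_of_neg_of_neg h2 h3, mul_nonneg (sq_nonneg (side M a b)) (neg_nonneg.2 h1.le)]

theorem sign_side_add {K L : T.elems} (hKL : K ≠ L) {a b : Plane} (hab : a ≠ b)
    (haK : a ∈ K.1) (hbK : b ∈ K.1) (haL : a ∈ L.1) (hbL : b ∈ L.1) :
    Real.sign (side L a b) = -Real.sign (side K a b) := by
  rcases mul_neg_iff.1 (T.side_mul_side_neg hKL hab haK hbK haL hbL) with ⟨h1, h2⟩ | ⟨h1, h2⟩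
  · rw [Real.sign_of_pos h1, Real.sign_of_neg h2]
  · rw [Real.sign_of_pos h2, Real.sign_of_neg h1, neg_neg]

theorem cross_eq_of_mem_W {q : T.BrokenField} (hq : q ∈ T.W) {K L : T.elems} {a b : Plane}
    (hab : a ≠ b) (haK : a ∈ K.1) (hbK : b ∈ K.1) (haL : a ∈ L.1) (hbL : b ∈ L.1) :
    cross (b - a) (q K (midpoint ℝ a b)) = cross (b - a) (q L (midpoint ℝ a b)) := by
  have := hq.2 K L a b hab haK hbK haL hbL !₂[(b - a) 1, -(b - a) 0]
    (by rw [inner_eq]; simp; ring) (midpoint ℝ a b) (midpoint_mem_segment a b)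
  simp only [inner_eq] at this
  simp at this
  simp only [cross, PiLp.sub_apply]
  linear_combination -this

/-- The normal component of a Raviart–Thomas field is constant along an edge, so matching it at the
midpoint is enough. -/
theorem mem_W_of_cross_eq {h : T.elems → Plane} {d : T.elems → ℝ}
    (H : ∀ K L : T.elems, K ≠ L → ∀ a b : Plane, a ≠ b → a ∈ K.1 → b ∈ K.1 → a ∈ L.1 → b ∈ L.1 →
      cross (b - a) (rt K (h K) (d K) (midpoint ℝ a b))
        = cross (b - a) (rt L (h L) (d L) (midpoint ℝ a b))) :
    (fun K => rt K (h K) (d K) : T.BrokenField) ∈ T.W := by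
  refine ⟨fun K => ⟨h K - d K • bary K, d K, fun x => by simp only [rt]; module⟩, ?_⟩
  intro K L a b hab haK hbK haL hbL n hn x hx
  by_cases hKL : K = L
  · subst hKL; rfl
  have hc := H K L hKL a b hab haK hbK haL hbL
  obtain ⟨t, -, rfl⟩ := (segment_eq_image' ℝ a b ▸ hx)
  have hw : 0 < (b 0 - a 0) ^ 2 + (b 1 - a 1) ^ 2 := by
    have : 0 < ‖b - a‖ ^ 2 := by
      have : b - a ≠ 0 := sub_ne_zero.2 hab.symm
      positivity
    simpa [normSq_eq] using this
  simp only [inner_eq, cross, rt, PiLp.sub_apply, PiLp.add_apply, PiLp.smul_apply, smul_eq_mul,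
    midpoint_apply] at hn hc ⊢
  refine mul_left_cancel₀ hw.ne' ?_
  -- With `e = b - a` and `p` the jump at `x`, this is `|e|² ⟨p, n⟩ = ⟨p, e⟩ ⟨n, e⟩ + cross e p *
  -- cross e n`.
  linear_combination (n 1 * (b 0 - a 0) - n 0 * (b 1 - a 1)) * hc
    + (((h K 0 + d K * (a 0 + t * (b 0 - a 0) - bary K 0)) * (b 0 - a 0)
      + (h K 1 + d K * (a 1 + t * (b 1 - a 1) - bary K 1)) * (b 1 - a 1))
      - ((h L 0 + d L * (a 0 + t * (b 0 - a 0) - bary L 0)) * (b 0 - a 0)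
      + (h L 1 + d L * (a 1 + t * (b 1 - a 1) - bary L 1)) * (b 1 - a 1))) * hn

/-- The discrete integration by parts formula for the nonconforming space. -/
theorem green (hΩ : IsConvexPolygonalDomain Ω) {c : T.elems → ℝ} {g h : T.elems → Plane}
    {d : T.elems → ℝ} (hv : (fun K => quad K (c K) (g K) 0 : T.BrokenFun) ∈ T.V)
    (hq : (fun K => rt K (h K) (d K) : T.BrokenField) ∈ T.W) :
    ∑ K : T.elems, volume.real (tri K.1) * (inner ℝ (g K) (h K) + 2 * d K * c K) = 0 := by
  classical
  set Φ : T.elems → Plane → Plane → ℝ := fun K a b => -Real.sign (side K a b) *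
    (quad K (c K) (g K) 0 (midpoint ℝ a b) * cross (b - a) (rt K (h K) (d K) (midpoint ℝ a b)))
    with hΦ
  set U : Finset Plane := T.elems.biUnion id with hU
  have hsub : ∀ K : T.elems, K.1 ⊆ U := fun K x hx =>
    Finset.mem_biUnion.2 ⟨K.1, K.2, hx⟩
  have h1 : ∀ K : T.elems, ∑ a ∈ K.1, ∑ b ∈ K.1, Φ K a b
      = ∑ a ∈ U, ∑ b ∈ U, if a ∈ K.1 ∧ b ∈ K.1 then Φ K a b else 0 := by
    intro K
    rw [← Finset.sum_subset (hsub K)]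
    · refine Finset.sum_congr rfl fun a ha => ?_
      rw [← Finset.sum_subset (hsub K)]
      · exact Finset.sum_congr rfl fun b hb => by rw [if_pos ⟨ha, hb⟩]
      · intro b _ hb
        rw [if_neg (fun h => hb h.2)]
    · intro a _ ha
      exact Finset.sum_eq_zero fun b _ => if_neg (fun h => ha h.1)
  -- For a fixed edge, either the midpoint value is zero by the boundary condition, or exactly two
  -- triangles contribute equal fluxes with opposite signs.
  have h2 : ∀ a b : Plane, ∑ K : T.elems, (if a ∈ K.1 ∧ b ∈ K.1 then Φ K a b else 0) = 0 := by
    intro a b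
    by_cases hab : a = b
    · refine Finset.sum_eq_zero fun K _ => ?_
      simp [hΦ, hab, cross]
    by_cases hm : midpoint ℝ a b ∈ frontier Ω
    · refine Finset.sum_eq_zero fun K _ => ?_
      split_ifs with hK
      · have := hv.2.2 K a b hab hK.1 hK.2 hm
        simp only at this
        simp only [hΦ, this, zero_mul, mul_zero]
      · rfl
    by_cases hex : ∃ K : T.elems, a ∈ K.1 ∧ b ∈ K.1
    · obtain ⟨K, haK, hbK⟩ := hex
      obtain ⟨L, hLK, haL, hbL⟩ := T.exists_neighbor hΩ K hab haK hbK hm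
      rw [T.sum_eq_add_of_common_edge hLK.symm hab haK hbK haL hbL _ fun M hM => if_neg hM,
        if_pos ⟨haK, hbK⟩, if_pos ⟨haL, hbL⟩]
      have e1 := hv.2.1 K L a b hab haK hbK haL hbL
      have e2 := T.cross_eq_of_mem_W hq hab haK hbK haL hbL
      simp only at e1 e2
      simp only [hΦ]
      rw [e1, e2, T.sign_side_add hLK.symm hab haK hbK haL hbL]
      ring
    · exact Finset.sum_eq_zero fun K _ => if_neg fun h => hex ⟨K, h⟩
  have h3 : 2 * ∑ K : T.elems, volume.real (tri K.1) * (inner ℝ (g K) (h K) + 2 * d K * c K) = 0 := by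
    rw [Finset.mul_sum, Finset.sum_congr rfl fun K _ =>
      ((T.isTriangle K).green (c K) (g K) (h K) (d K)).trans (h1 K), Finset.sum_comm]
    refine Finset.sum_eq_zero fun a _ => ?_
    rw [Finset.sum_comm]
    exact Finset.sum_eq_zero fun b _ => h2 a b
  linarith

/-! ### Edge basis functions and recovery of normal continuity -/

open Classical in
/-- The nonconforming basis function of the edge with end points `a` and `b`. -/
def edgeFun (a b : Plane) : T.BrokenFun := fun K x =>
  if a ∈ K.1 ∧ b ∈ K.1 then 1 - 2 * cross (b - a) (x - a) / (3 * side K a b) else 0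

-- On a triangle with third vertex `c`, `3 * side` equals `cross (b - a) (c - a)`, so the function
-- is one minus twice the barycentric coordinate at `c`.
open Classical in
theorem edgeFun_midpoint {a b : Plane} (hab : a ≠ b) (K : T.elems) {a' b' : Plane}
    (hab' : a' ≠ b') (ha' : a' ∈ K.1) (hb' : b' ∈ K.1) :
    T.edgeFun a b K (midpoint ℝ a' b') = if a' = a ∧ b' = b ∨ a' = b ∧ b' = a then 1 else 0 := by
  rw [edgeFun]
  split_ifs with h1 h2 h2
  · have : cross (b - a) (midpoint ℝ a' b' - a) = 0 := by
      rcases h2 with ⟨rfl, rfl⟩ | ⟨rfl, rfl⟩ <;>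
        simp only [cross, PiLp.sub_apply, midpoint_apply] <;> ring
    rw [this]
    simp
  · obtain ⟨c, hac, hbc, hK, hD⟩ := (T.isTriangle K).exists_eq_of_mem hab h1.1 h1.2
    have hs : 3 * side K a b = cross (b - a) (c - a) := by
      rw [hK, side_eq hab hac hbc]; ring
    rw [hs, sub_eq_zero, eq_div_iff hD, one_mul]
    rw [hK] at ha' hb'
    simp only [Finset.mem_insert, Finset.mem_singleton] at ha' hb'
    rcases ha' with rfl | rfl | rfl <;> rcases hb' with rfl | rfl | rfl
    all_goals first
      | exact absurd rfl hab'
      | exact absurd (Or.inl ⟨rfl, rfl⟩) h2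
      | exact absurd (Or.inr ⟨rfl, rfl⟩) h2
      | (simp only [cross, PiLp.sub_apply, midpoint_apply]; ring)
  · rcases h2 with ⟨rfl, rfl⟩ | ⟨rfl, rfl⟩
    · exact absurd ⟨ha', hb'⟩ h1
    · exact absurd ⟨hb', ha'⟩ h1
  · rfl

theorem edgeFun_mem_V {a b : Plane} (hab : a ≠ b) (hm : midpoint ℝ a b ∉ frontier Ω) :
    T.edgeFun a b ∈ T.V := by
  classical
  refine ⟨fun K => ?_, fun K L a' b' h1 h2 h3 h4 h5 => ?_, fun K a' b' h1 h2 h3 h4 => ?_⟩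
  · by_cases h : a ∈ K.1 ∧ b ∈ K.1
    · refine ⟨AffineMap.const ℝ Plane (1 + 2 * cross (b - a) a / (3 * side K a b)) -
        ((2 / (3 * side K a b)) • (isLinearMap_cross (b - a)).mk' _).toAffineMap, fun x => ?_⟩
      simp only [edgeFun, if_pos h, (isLinearMap_cross (b - a)).map_sub]
      simp
      ring
    · exact ⟨0, fun x => by simp only [edgeFun, if_neg h]; rfl⟩
  · rw [T.edgeFun_midpoint hab K h1 h2 h3, T.edgeFun_midpoint hab L h1 h4 h5]
  · rw [T.edgeFun_midpoint hab K h1 h2 h3, if_neg]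
    rintro (⟨rfl, rfl⟩ | ⟨rfl, rfl⟩)
    · exact hm h4
    · exact hm (by rwa [midpoint_comm])

/-- The flux correction of a nonconforming solution is a Raviart–Thomas field. -/
theorem rt_mem_W_of_forall_V (hΩ : IsConvexPolygonalDomain Ω) {g : T.elems → Plane}
    {d : T.elems → ℝ}
    (H : ∀ (c' : T.elems → ℝ) (g' : T.elems → Plane),
      (fun K => quad K (c' K) (g' K) 0 : T.BrokenFun) ∈ T.V →
      ∑ K : T.elems, volume.real (tri K.1) * (inner ℝ (g' K) (g K) + 2 * d K * c' K) = 0) :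
    (fun K => rt K (g K) (d K) : T.BrokenField) ∈ T.W := by
  classical
  refine T.mem_W_of_cross_eq fun K L hKL a b hab haK hbK haL hbL => ?_
  have hV := T.edgeFun_mem_V hab (T.midpoint_notMem_frontier hΩ hKL hab haK hbK haL hbL)
  obtain ⟨c', g', hrep⟩ := T.exists_quad_of_mem_V hV
  have h1 := H c' g' (hrep ▸ hV)
  have hsymm : ∀ M : Finset Plane, side M b a = -side M a b := fun M => by
    simp only [side, cross, PiLp.sub_apply]; ring
  have flip : ∀ w : Plane, cross (a - b) w = -cross (b - a) w := fun w => by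
    simp only [cross, PiLp.sub_apply]; ring
  -- `ψ M` is the flux out of `M` through the edge. Green's double sum meets it once for each
  -- orientation, hence the total `2 * ψ M`.
  set ψ : T.elems → ℝ := fun M => if a ∈ M.1 ∧ b ∈ M.1 then
    -Real.sign (side M a b) * cross (b - a) (rt M (g M) (d M) (midpoint ℝ a b)) else 0 with hψ
  have h2 : ∀ M : T.elems,
      volume.real (tri M.1) * (inner ℝ (g' M) (g M) + 2 * d M * c' M) = ψ M := by
    intro M
    have hG := (T.isTriangle M).green (c' M) (g' M) (g M) (d M)
    have hval : ∀ x y : Plane, x ∈ M.1 → y ∈ M.1 → x ≠ y →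
        quad M (c' M) (g' M) 0 (midpoint ℝ x y)
          = if x = a ∧ y = b ∨ x = b ∧ y = a then 1 else 0 := fun x y hx hy hxy => by
      rw [← T.edgeFun_midpoint hab M hxy hx hy, hrep]
    suffices hS : ∑ x ∈ M.1, ∑ y ∈ M.1, -Real.sign (side M x y) *
        (quad M (c' M) (g' M) 0 (midpoint ℝ x y) *
          cross (y - x) (rt M (g M) (d M) (midpoint ℝ x y))) = 2 * ψ M by
      linarith
    have hterm : ∀ x ∈ M.1, ∀ y ∈ M.1, -Real.sign (side M x y) *
        (quad M (c' M) (g' M) 0 (midpoint ℝ x y) *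
          cross (y - x) (rt M (g M) (d M) (midpoint ℝ x y))) =
        (if x = a ∧ y = b then ψ M else 0)
          + (if x = b ∧ y = a then ψ M else 0) := by
      intro x hx y hy
      by_cases hxy : x = y
      · subst hxy
        have e1 : ¬ (x = a ∧ x = b) := fun h => hab (h.1.symm.trans h.2)
        rw [if_neg e1, if_neg fun h => e1 h.symm]
        simp [cross]
      rw [hval x y hx hy hxy]
      by_cases e1 : x = a ∧ y = b
      · obtain ⟨rfl, rfl⟩ := e1
        simp [hψ, hx, hy, hab]
      by_cases e2 : x = b ∧ y = a
      · obtain ⟨rfl, rfl⟩ := e2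
        rw [hsymm, flip, midpoint_comm (R := ℝ) x y, Real.sign_neg]
        simp [hψ, hx, hy, hab.symm]
      · rw [if_neg e1, if_neg e2, if_neg (not_or.2 ⟨e1, e2⟩)]
        ring
    rw [Finset.sum_congr rfl fun x hx => Finset.sum_congr rfl fun y hy => hterm x hx y hy]
    simp only [Finset.sum_add_distrib]
    by_cases hM : a ∈ M.1 ∧ b ∈ M.1
    · have e : ∀ p q : Plane, p ∈ M.1 → q ∈ M.1 →
          ∑ x ∈ M.1, ∑ y ∈ M.1, (if x = p ∧ y = q then ψ M else 0) = ψ M := by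
        intro p q hp hq
        rw [Finset.sum_eq_single_of_mem p hp fun x _ hx => by simp [hx]]
        simp [hq]
      rw [e a b hM.1 hM.2, e b a hM.2 hM.1]
      ring
    · have : ψ M = 0 := if_neg hM
      simp [this]
  rw [Finset.sum_congr rfl fun M _ => h2 M,
    T.sum_eq_add_of_common_edge hKL hab haK hbK haL hbL ψ fun M hM => if_neg hM] at h1
  simp only [hψ, if_pos (And.intro haK hbK), if_pos (And.intro haL hbL),
    T.sign_side_add hKL hab haK hbK haL hbL] at h1
  have hs : Real.sign (side K a b) ≠ 0 := by
    rw [Ne, Real.sign_eq_zero_iff]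
    exact (T.isTriangle K).side_ne_zero hab haK hbK
  refine mul_left_cancel₀ hs ?_
  linear_combination -h1

end Triangulation

/-! ### The discrete forms as area-weighted sums -/

theorem sum_mul_eq_zero {ι : Type*} [Fintype ι] {w x : ι → ℝ} (hw : ∀ i, 0 < w i)
    (hx : ∀ i, 0 ≤ x i) (h : ∑ i, w i * x i = 0) (i : ι) : x i = 0 := by
  have := (Finset.sum_eq_zero_iff_of_nonneg fun i _ => mul_nonneg (hw i).le (hx i)).1 h i
    (Finset.mem_univ i)
  exact (mul_eq_zero.1 this).resolve_left (hw i).ne'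

theorem IsTriangle.secondMoment_eq {K : Finset Plane} (hK : IsTriangle K) :
    secondMoment K = 1 / 12 * (∑ v ∈ K, ‖v‖ ^ 2 - 3 * ‖bary K‖ ^ 2) := by
  classical
  obtain ⟨a, b, c, hab, hac, hbc, rfl, -⟩ := hK.exists_eq
  simp only [secondMoment, bary, sum_triple hab hac hbc, normSq_eq, PiLp.sub_apply, PiLp.add_apply,
    PiLp.smul_apply, smul_eq_mul]
  ring

theorem rt_sub (K : Finset Plane) (g h : Plane) (s t : ℝ) :
    rt K g s - rt K h t = rt K (g - h) (s - t) := by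
  ext1 x
  simp only [rt, Pi.sub_apply]
  module

namespace Triangulation

variable {Ω : Set Plane} (T : Triangulation Ω)

theorem volume_pos (K : T.elems) : 0 < volume.real (tri K.1) := (T.isTriangle K).volume_real_pos

theorem gradh_quad (c : T.elems → ℝ) (g : T.elems → Plane) (s : T.elems → ℝ) :
    T.gradh (fun K : T.elems => quad K (c K) (g K) (s K)) = fun K : T.elems => rt K (g K) (s K) :=
  funext fun K => gradient_quad K (c K) (g K) (s K)

theorem divh_rt (g : T.elems → Plane) (s : T.elems → ℝ) :
    T.divh (fun K : T.elems => rt K (g K) (s K)) = fun K _ => 2 * s K :=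
  funext fun K => funext fun x => divergence_rt K (g K) (s K) x

theorem innerV_rt (g h : T.elems → Plane) (s t : T.elems → ℝ) :
    T.innerV (fun K : T.elems => rt K (g K) (s K)) (fun K : T.elems => rt K (h K) (t K))
      = ∑ K : T.elems, volume.real (tri K.1) *
          (inner ℝ (g K) (h K) + s K * t K * secondMoment K) :=
  Finset.sum_congr rfl fun K _ => (T.isTriangle K).setIntegral_inner_rt _ _ _ _

theorem innerS_const_quad (F c : T.elems → ℝ) (g : T.elems → Plane) (s : T.elems → ℝ) :
    T.innerS (fun K _ => F K) (fun K : T.elems => quad K (c K) (g K) (s K))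
      = ∑ K : T.elems, volume.real (tri K.1) * (F K * (c K + s K / 2 * secondMoment K)) := by
  refine Finset.sum_congr rfl fun K _ => ?_
  simp only [integral_const_mul, (T.isTriangle K).setIntegral_quad]
  ring

theorem innerS_const_const (F G : T.elems → ℝ) :
    T.innerS (fun K _ => F K) (fun K _ => G K)
      = ∑ K : T.elems, volume.real (tri K.1) * (F K * G K) := by
  refine Finset.sum_congr rfl fun K _ => ?_
  simp

theorem Qh_quad (c : T.elems → ℝ) (g : T.elems → Plane) (s : T.elems → ℝ) :
    T.Qh (fun K : T.elems => quad K (c K) (g K) (s K)) = fun K _ => c K + s K / 2 * secondMoment K := by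
  ext K x
  rw [Qh, mean, (T.isTriangle K).setIntegral_quad, mul_div_cancel_left₀ _ (T.volume_pos K).ne']

theorem mem_VB_iff {v : T.BrokenFun} :
    v ∈ T.VB ↔ ∃ α : T.elems → ℝ,
      v = fun K : T.elems => quad K (-(α K * secondMoment K)) 0 (α K) := by
  classical
  rw [VB, Submodule.mem_span_range_iff_exists_fun]
  refine exists_congr fun α => ?_
  have : ∑ K, α K • T.phi K = fun K : T.elems => quad K (-(α K * secondMoment K)) 0 (α K) := by
    ext K x
    rw [Finset.sum_apply, Finset.sum_apply, Finset.sum_eq_single K]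
    · simp only [phi, Pi.smul_apply, Pi.single_eq_same, bubble_eq_quad, quad, inner_zero_left,
        smul_eq_mul]
      ring
    · intro L _ hL
      simp [phi, Pi.single_eq_of_ne hL.symm]
    · simp
  rw [this, eq_comm]

/-- A nonconforming function with vanishing discrete gradient vanishes. -/
theorem eq_zero_of_quad_mem_V (hΩ : IsConvexPolygonalDomain Ω) {c : T.elems → ℝ}
    (hv : (fun K : T.elems => quad K (c K) 0 0 : T.BrokenFun) ∈ T.V) (K : T.elems) : c K = 0 := by
  -- For piecewise constants, membership in `V` survives squaring. Green's formula with the field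
  -- `q(x) = x`, of divergence 2, then turns into a vanishing sum of nonnegative terms.
  have hv2 : (fun K : T.elems => quad K (c K ^ 2) ((fun _ => 0 : T.elems → Plane) K) 0 : T.BrokenFun)
      ∈ T.V := by
    refine ⟨fun K => exists_affine_of_quad K _ _, fun K L a b h h1 h2 h3 h4 => ?_,
      fun K a b h h1 h2 h3 => ?_⟩
    · have := hv.2.1 K L a b h h1 h2 h3 h4
      simp only [quad_zero_zero] at this ⊢
      rw [this]
    · have := hv.2.2 K a b h h1 h2 h3
      simp only [quad_zero_zero] at this ⊢
      rw [this, zero_pow two_ne_zero]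
  have hq : (fun K : T.elems => rt K (bary K) ((fun _ => 1 : T.elems → ℝ) K) : T.BrokenField)
      ∈ T.W := by
    refine T.mem_W_of_cross_eq fun K L _ a b _ _ _ _ _ => ?_
    simp [rt]
  have h := T.green hΩ hv2 hq
  refine pow_eq_zero_iff two_ne_zero |>.1 (sum_mul_eq_zero (w := fun K : T.elems =>
    volume.real (tri K.1) * 2) (x := fun K => c K ^ 2)
    (fun K => mul_pos (T.volume_pos K) two_pos) (fun K => sq_nonneg _) ?_ K)
  rw [← h]
  refine Finset.sum_congr rfl fun K _ => ?_
  simp only [inner_zero_left]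
  ring

/-! ### The three Galerkin problems -/

theorem galerkin_V_iff {F c : T.elems → ℝ} {g : T.elems → Plane} :
    T.IsGalerkinSolution T.V (fun K _ => F K) (fun K : T.elems => quad K (c K) (g K) 0) ↔
      (fun K : T.elems => quad K (c K) (g K) 0 : T.BrokenFun) ∈ T.V ∧
      ∀ (c' : T.elems → ℝ) (g' : T.elems → Plane),
        (fun K : T.elems => quad K (c' K) (g' K) 0 : T.BrokenFun) ∈ T.V →
        ∑ K : T.elems, volume.real (tri K.1) * inner ℝ (g K) (g' K)
          = ∑ K : T.elems, volume.real (tri K.1) * (F K * c' K) := by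
  have key : ∀ (c' : T.elems → ℝ) (g' : T.elems → Plane),
      (T.innerV (T.gradh fun K : T.elems => quad K (c K) (g K) 0)
        (T.gradh fun K : T.elems => quad K (c' K) (g' K) 0)
        = T.innerS (fun K _ => F K) (fun K : T.elems => quad K (c' K) (g' K) 0)) ↔
      ∑ K : T.elems, volume.real (tri K.1) * inner ℝ (g K) (g' K)
          = ∑ K : T.elems, volume.real (tri K.1) * (F K * c' K) := by
    intro c' g'
    have h1 := T.gradh_quad c g fun _ => 0
    have h2 := T.gradh_quad c' g' fun _ => 0
    have h3 := T.innerV_rt g g' (fun _ => 0) fun _ => 0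
    have h4 := T.innerS_const_quad F c' g' fun _ => 0
    simp only [zero_mul, zero_div, add_zero] at h1 h2 h3 h4
    rw [h1, h2, h3, h4]
  refine and_congr_right fun _ => ⟨fun h c' g' hv => (key c' g').1 (h _ hv), fun h v hv => ?_⟩
  obtain ⟨c', g', rfl⟩ := T.exists_quad_of_mem_V hv
  exact (key c' g').2 (h c' g' hv)

/-- The elementwise gradients of the nonconforming functions. -/
def gradV : T.V →ₗ[ℝ] (T.elems → Plane) where
  -- Gradients are constant on each element, so the evaluation point `0` is immaterial.
  toFun v K := gradient (v.1 K) 0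
  map_add' := by
    rintro ⟨u, hu⟩ ⟨v, hv⟩
    obtain ⟨c, g, rfl⟩ := T.exists_quad_of_mem_V hu
    obtain ⟨c', g', rfl⟩ := T.exists_quad_of_mem_V hv
    ext1 K
    simp only [Submodule.coe_add, Pi.add_apply, quad_add, gradient_quad]
    simp [rt]
  map_smul' := by
    rintro r ⟨u, hu⟩
    obtain ⟨c, g, rfl⟩ := T.exists_quad_of_mem_V hu
    ext1 K
    simp only [Submodule.coe_smul, Pi.smul_apply, smul_quad, gradient_quad]
    simp [rt]

theorem gradV_quad {c : T.elems → ℝ} {g : T.elems → Plane}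
    (h : (fun K : T.elems => quad K (c K) (g K) 0 : T.BrokenFun) ∈ T.V) : T.gradV ⟨_, h⟩ = g := by
  ext1 K
  simp [gradV, gradient_quad, rt]

theorem gradV_injective (hΩ : IsConvexPolygonalDomain Ω) : Function.Injective T.gradV := by
  rw [injective_iff_map_eq_zero]
  rintro ⟨v, hv⟩ h
  obtain ⟨c, g, rfl⟩ := T.exists_quad_of_mem_V hv
  rw [T.gradV_quad] at h
  subst h
  have := T.eq_zero_of_quad_mem_V hΩ hv
  ext K x
  simp [this]

/-- Injectivity of the gradient makes `V` finite-dimensional and the energy form definite, so the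
induced map to the dual is injective and hence onto. -/
theorem exists_galerkin_V (hΩ : IsConvexPolygonalDomain Ω) (F : T.elems → ℝ) :
    ∃ u, T.IsGalerkinSolution T.V (fun K _ => F K) u := by
  have hfin : FiniteDimensional ℝ T.V :=
    FiniteDimensional.of_injective T.gradV (T.gradV_injective hΩ)
  let B : T.V →ₗ[ℝ] Module.Dual ℝ T.V := LinearMap.mk₂ ℝ
    (fun u v => ∑ K : T.elems, volume.real (tri K.1) * inner ℝ (T.gradV u K) (T.gradV v K))
    (fun u u' v => by simp [inner_add_left, mul_add, Finset.sum_add_distrib])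
    (fun r u v => by simp [inner_smul_left, Finset.mul_sum, mul_left_comm])
    (fun u v v' => by simp [inner_add_right, mul_add, Finset.sum_add_distrib])
    (fun r u v => by simp [inner_smul_right, Finset.mul_sum, mul_left_comm])
  -- The mean of an affine function is its value at the barycenter, so this is the load functional
  -- in visibly linear form.
  let l : Module.Dual ℝ T.V :=
    { toFun := fun v => ∑ K : T.elems, volume.real (tri K.1) * (F K * v.1 K (bary K))
      map_add' := fun u v => by simp [mul_add, Finset.sum_add_distrib]
      map_smul' := fun r u => by simp [Finset.mul_sum, mul_left_comm] }
  have hB : Function.Injective B := by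
    rw [injective_iff_map_eq_zero]
    intro u hu
    have h0 : ∑ K : T.elems, volume.real (tri K.1) * inner ℝ (T.gradV u K) (T.gradV u K) = 0 :=
      LinearMap.congr_fun hu u
    refine T.gradV_injective hΩ ?_
    rw [map_zero]
    ext1 K
    exact inner_self_eq_zero.1 (sum_mul_eq_zero T.volume_pos (fun K => real_inner_self_nonneg) h0 K)
  obtain ⟨u, hu⟩ := (LinearMap.injective_iff_surjective_of_finrank_eq_finrank
    Subspace.dual_finrank_eq.symm).1 hB l
  obtain ⟨u, hu0⟩ := u
  obtain ⟨c, g, rfl⟩ := T.exists_quad_of_mem_V hu0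
  refine ⟨_, T.galerkin_V_iff.2 ⟨hu0, fun c' g' hv => ?_⟩⟩
  have : ∑ K : T.elems, volume.real (tri K.1) *
      inner ℝ (T.gradV ⟨_, hu0⟩ K) (T.gradV ⟨_, hv⟩ K) =
    ∑ K : T.elems, volume.real (tri K.1) * (F K * quad K (c' K) (g' K) 0 (bary K)) :=
    LinearMap.congr_fun hu ⟨_, hv⟩
  simpa only [T.gradV_quad, quad_bary] using this

theorem galerkin_V_unique (hΩ : IsConvexPolygonalDomain Ω) {F : T.elems → ℝ} {u v : T.BrokenFun}
    (hu : T.IsGalerkinSolution T.V (fun K _ => F K) u)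
    (hv : T.IsGalerkinSolution T.V (fun K _ => F K) v) : u = v := by
  obtain ⟨c, g, rfl⟩ := T.exists_quad_of_mem_V hu.1
  obtain ⟨c', g', rfl⟩ := T.exists_quad_of_mem_V hv.1
  have hg : g = g' := by
    have hsub : (fun K : T.elems => quad K ((c - c') K) ((g - g') K) 0 : T.BrokenFun) ∈ T.V := by
      have := T.V.sub_mem hu.1 hv.1
      convert this using 1
      ext K x
      simp only [quad, Pi.sub_apply, inner_sub_left]
      ring
    have h1 := (T.galerkin_V_iff.1 hu).2 _ _ hsub
    have h2 := (T.galerkin_V_iff.1 hv).2 _ _ hsub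
    have h3 : ∑ K : T.elems, volume.real (tri K.1) * inner ℝ ((g - g') K) ((g - g') K) = 0 := by
      have := sub_eq_zero.2 (h1.trans h2.symm)
      rw [← Finset.sum_sub_distrib] at this
      rw [← this]
      refine Finset.sum_congr rfl fun K _ => ?_
      rw [← mul_sub, ← inner_sub_left, Pi.sub_apply]
    ext1 K
    exact sub_eq_zero.1 (inner_self_eq_zero.1
      (sum_mul_eq_zero T.volume_pos (fun K => real_inner_self_nonneg) h3 K))
  subst hg
  have := T.gradV_injective hΩ (a₁ := ⟨_, hu.1⟩) (a₂ := ⟨_, hv.1⟩)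
    (by rw [T.gradV_quad, T.gradV_quad])
  exact congrArg Subtype.val this

/-- The solution of the bubble problem with the piecewise constant load `F`. -/
def bubbleSol (F : T.elems → ℝ) : T.BrokenFun := fun K =>
  quad K (F K / 2 * secondMoment K) 0 (-F K / 2)

theorem bubbleSol_mem_VB (F : T.elems → ℝ) : T.bubbleSol F ∈ T.VB :=
  T.mem_VB_iff.2 ⟨fun K => -F K / 2, funext fun K => by
    simp only [bubbleSol]
    congr 1
    ring⟩

/-- Mixed terms are absent because `x - x^G` has mean zero on each triangle. -/
theorem innerV_gradh_add {c c' : T.elems → ℝ} {g g' : T.elems → Plane} {α β : T.elems → ℝ} :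
    T.innerV
      (T.gradh ((fun K : T.elems => quad K (c K) (g K) 0)
        + fun K : T.elems => quad K (-(α K * secondMoment K)) 0 (α K)))
      (T.gradh ((fun K : T.elems => quad K (c' K) (g' K) 0)
        + fun K : T.elems => quad K (-(β K * secondMoment K)) 0 (β K)))
      = ∑ K : T.elems, volume.real (tri K.1) * inner ℝ (g K) (g' K)
        + ∑ K : T.elems, volume.real (tri K.1) * (α K * β K * secondMoment K) := by
  have e : ∀ (c : T.elems → ℝ) (g : T.elems → Plane) (α : T.elems → ℝ),
      ((fun K : T.elems => quad K (c K) (g K) 0 : T.BrokenFun)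
        + fun K : T.elems => quad K (-(α K * secondMoment K)) 0 (α K))
      = fun K : T.elems => quad K (c K + -(α K * secondMoment K)) (g K) (α K) := by
    intro c g α
    ext1 K
    rw [Pi.add_apply, quad_add, add_zero, zero_add]
  rw [e, e, T.gradh_quad (fun K => c K + -(α K * secondMoment K)),
    T.gradh_quad (fun K => c' K + -(β K * secondMoment K)), T.innerV_rt, ← Finset.sum_add_distrib]
  simp only [mul_add]

theorem innerS_const_add {F c : T.elems → ℝ} {g : T.elems → Plane} {β : T.elems → ℝ} :
    T.innerS (fun K _ => F K) ((fun K : T.elems => quad K (c K) (g K) 0)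
        + fun K : T.elems => quad K (-(β K * secondMoment K)) 0 (β K))
      = ∑ K : T.elems, volume.real (tri K.1) * (F K * c K)
        + ∑ K : T.elems, volume.real (tri K.1) * (-F K / 2 * β K * secondMoment K) := by
  have e : ((fun K : T.elems => quad K (c K) (g K) 0 : T.BrokenFun)
        + fun K : T.elems => quad K (-(β K * secondMoment K)) 0 (β K))
      = fun K : T.elems => quad K (c K + -(β K * secondMoment K)) (g K) (β K) := by
    ext1 K
    rw [Pi.add_apply, quad_add, add_zero, zero_add]
  rw [e, T.innerS_const_quad F (fun K => c K + -(β K * secondMoment K)), ← Finset.sum_add_distrib]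
  refine Finset.sum_congr rfl fun K _ => ?_
  ring

theorem zero_add_quad (v : T.BrokenFun) :
    v = (fun K : T.elems => quad K ((0 : T.elems → ℝ) K) ((0 : T.elems → Plane) K) 0) + v := by
  ext K x
  simp

/-- The system is diagonal: per unit area a bubble has energy `secondMoment K` and mean
`-secondMoment K / 2`. -/
theorem galerkin_VB_iff {F : T.elems → ℝ} {a : T.BrokenFun} :
    T.IsGalerkinSolution T.VB (fun K _ => F K) a ↔ a = T.bubbleSol F := by
  have key : ∀ α β : T.elems → ℝ,
      (T.innerV (T.gradh fun K : T.elems => quad K (-(α K * secondMoment K)) 0 (α K))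
        (T.gradh fun K : T.elems => quad K (-(β K * secondMoment K)) 0 (β K))
        = T.innerS (fun K _ => F K) (fun K : T.elems => quad K (-(β K * secondMoment K)) 0 (β K))) ↔
      ∑ K : T.elems, volume.real (tri K.1) * (α K * β K * secondMoment K)
        = ∑ K : T.elems, volume.real (tri K.1) * (-F K / 2 * β K * secondMoment K) := by
    intro α β
    rw [T.zero_add_quad fun K : T.elems => quad K (-(α K * secondMoment K)) 0 (α K),
      T.zero_add_quad fun K : T.elems => quad K (-(β K * secondMoment K)) 0 (β K),
      T.innerV_gradh_add, T.innerS_const_add]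
    simp
  have hsol : T.bubbleSol F = fun K : T.elems =>
      quad K (-((-F K / 2) * secondMoment K)) 0 (-F K / 2) := by
    ext1 K
    simp only [bubbleSol]
    congr 1
    ring
  constructor
  · rintro ⟨ha, h⟩
    obtain ⟨α, rfl⟩ := T.mem_VB_iff.1 ha
    -- Testing with the difference from the expected solution yields a weighted sum of squares.
    have h1 := (key α fun K => α K + F K / 2).1 (h _ (T.mem_VB_iff.2 ⟨_, rfl⟩))
    have h2 : ∑ K : T.elems, (volume.real (tri K.1) * secondMoment K) * (α K + F K / 2) ^ 2 = 0 := by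
      rw [← sub_eq_zero, ← Finset.sum_sub_distrib] at h1
      rw [← h1]
      refine Finset.sum_congr rfl fun K _ => ?_
      ring
    have h3 : α = fun K => -F K / 2 := by
      ext1 K
      have := sum_mul_eq_zero (fun K => mul_pos (T.volume_pos K) (secondMoment_pos (T.isTriangle K)))
        (fun K => sq_nonneg _) h2 K
      have := pow_eq_zero_iff two_ne_zero |>.1 this
      linarith
    rw [hsol, h3]
  · rintro rfl
    refine ⟨T.bubbleSol_mem_VB F, fun v hv => ?_⟩
    obtain ⟨β, rfl⟩ := T.mem_VB_iff.1 hv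
    rw [hsol]
    exact (key (fun K => -F K / 2) β).2 rfl

/-- Both the energy and the load split over the two summands, so testing with each one separately
decouples the problem. -/
theorem galerkin_Vt_iff {F : T.elems → ℝ} {w : T.BrokenFun} :
    T.IsGalerkinSolution T.Vt (fun K _ => F K) w ↔
      ∃ u, T.IsGalerkinSolution T.V (fun K _ => F K) u ∧ w = u + T.bubbleSol F := by
  constructor
  · rintro ⟨hw, h⟩
    obtain ⟨u, hu, a, ha, rfl⟩ := Submodule.mem_sup.1 hw
    refine ⟨u, ?_, ?_⟩
    · obtain ⟨c, g, rfl⟩ := T.exists_quad_of_mem_V hu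
      obtain ⟨α, rfl⟩ := T.mem_VB_iff.1 ha
      refine T.galerkin_V_iff.2 ⟨hu, fun c' g' hv => ?_⟩
      have h1 := h _ (Submodule.add_mem_sup hv
        (T.mem_VB_iff.2 ⟨(fun _ => 0 : T.elems → ℝ), rfl⟩))
      rw [T.innerV_gradh_add, T.innerS_const_add] at h1
      simpa using h1
    · have hs : T.IsGalerkinSolution T.VB (fun K _ => F K) a := by
        refine ⟨ha, fun b hb => ?_⟩
        have h1 := h _ (Submodule.mem_sup_right hb)
        obtain ⟨c, g, rfl⟩ := T.exists_quad_of_mem_V hu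
        obtain ⟨α, rfl⟩ := T.mem_VB_iff.1 ha
        obtain ⟨β, rfl⟩ := T.mem_VB_iff.1 hb
        rw [T.zero_add_quad fun K : T.elems => quad K (-(β K * secondMoment K)) 0 (β K),
          T.innerV_gradh_add, T.innerS_const_add] at h1
        rw [T.zero_add_quad fun K : T.elems => quad K (-(α K * secondMoment K)) 0 (α K),
          T.zero_add_quad fun K : T.elems => quad K (-(β K * secondMoment K)) 0 (β K),
          T.innerV_gradh_add, T.innerS_const_add]
        simpa using h1
      rw [T.galerkin_VB_iff.1 hs]
  · rintro ⟨u, hu, rfl⟩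
    refine ⟨Submodule.add_mem_sup hu.1 (T.bubbleSol_mem_VB F), fun v hv => ?_⟩
    obtain ⟨v, hvV, b, hb, rfl⟩ := Submodule.mem_sup.1 hv
    have ha := T.galerkin_VB_iff.2 (rfl : T.bubbleSol F = T.bubbleSol F)
    generalize T.bubbleSol F = a at ha ⊢
    obtain ⟨c, g, rfl⟩ := T.exists_quad_of_mem_V hu.1
    obtain ⟨c', g', rfl⟩ := T.exists_quad_of_mem_V hvV
    have h1 := (T.galerkin_V_iff.1 hu).2 c' g' hvV
    have h2 := ha.2 b hb
    obtain ⟨α, rfl⟩ := T.mem_VB_iff.1 ha.1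
    obtain ⟨β, rfl⟩ := T.mem_VB_iff.1 hb
    rw [T.zero_add_quad fun K : T.elems => quad K (-(α K * secondMoment K)) 0 (α K),
      T.zero_add_quad fun K : T.elems => quad K (-(β K * secondMoment K)) 0 (β K),
      T.innerV_gradh_add, T.innerS_const_add] at h2
    rw [T.innerV_gradh_add, T.innerS_const_add, h1]
    simpa using h2

/-- Gradients are constant in `V` but equal `α K • (x - x^G)` for bubbles; comparing two points
forces `α = 0`. -/
theorem disjoint_V_VB : Disjoint T.V T.VB := by
  rw [Submodule.disjoint_def]
  intro v hv hb
  obtain ⟨c, g, h1⟩ := T.exists_quad_of_mem_V hv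
  obtain ⟨α, h2⟩ := T.mem_VB_iff.1 hb
  have hα : α = 0 := by
    ext1 K
    have e : quad K (c K) (g K) 0 = quad K (-(α K * secondMoment K)) 0 (α K) :=
      congrFun (h1.symm.trans h2) K
    have e' := congrArg gradient e
    rw [gradient_quad, gradient_quad] at e'
    have e0 := congrFun e' (bary K)
    have e1 := congrFun e' (bary K + EuclideanSpace.single 0 1)
    simp only [rt, sub_self, smul_zero, add_zero, zero_smul, zero_add, add_sub_cancel_left] at e0 e1
    rw [e0] at e1
    have := congrArg (fun z : Plane => z 0) e1
    simpa using this.symm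
  rw [h2, hα]
  ext K x
  simp

/-! ### The mixed method -/

theorem sol_eq_quad {F c : T.elems → ℝ} {g : T.elems → Plane} :
    (fun K : T.elems => quad K (c K) (g K) 0 : T.BrokenFun) + T.bubbleSol F
      = fun K : T.elems => quad K (c K + F K / 2 * secondMoment K) (g K) (-F K / 2) := by
  ext1 K
  rw [Pi.add_apply, bubbleSol, quad_add, add_zero, zero_add]

theorem rt_mem_W_of_galerkin (hΩ : IsConvexPolygonalDomain Ω) {F c : T.elems → ℝ}
    {g : T.elems → Plane}
    (hu : T.IsGalerkinSolution T.V (fun K _ => F K) (fun K : T.elems => quad K (c K) (g K) 0)) :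
    (fun K : T.elems => rt K (g K) (-F K / 2) : T.BrokenField) ∈ T.W := by
  refine T.rt_mem_W_of_forall_V (d := fun K => -F K / 2) hΩ fun c' g' hv => ?_
  have := (T.galerkin_V_iff.1 hu).2 c' g' hv
  rw [← sub_eq_zero, ← Finset.sum_sub_distrib] at this
  rw [← this]
  refine Finset.sum_congr rfl fun K _ => ?_
  rw [real_inner_comm]
  ring

/-- In the first equation the bubble parts of the flux and of the mean cancel, `-F d m / 2` against
`2 d (F m / 2 - F m / 4)` with `m` the second moment, leaving Green's formula. The second says that
the divergence is `-F`. -/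
theorem isMixedSolution_of_galerkin (hΩ : IsConvexPolygonalDomain Ω) {F : T.elems → ℝ}
    {w : T.BrokenFun} (hw : T.IsGalerkinSolution T.Vt (fun K _ => F K) w) :
    T.IsMixedSolution (fun K _ => F K) (T.gradh w) (T.Qh w) := by
  obtain ⟨u, hu, rfl⟩ := T.galerkin_Vt_iff.1 hw
  obtain ⟨c, g, rfl⟩ := T.exists_quad_of_mem_V hu.1
  refine ⟨?_, T.Qh_mem _, fun q hq => ?_, fun v hv => ?_⟩
  · rw [T.sol_eq_quad, T.gradh_quad (fun K => c K + F K / 2 * secondMoment K) g fun K => -F K / 2]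
    exact T.rt_mem_W_of_galerkin hΩ hu
  · obtain ⟨h, d, rfl⟩ := T.exists_rt_of_mem_W hq
    rw [T.sol_eq_quad, T.gradh_quad (fun K => c K + F K / 2 * secondMoment K) g fun K => -F K / 2,
      T.Qh_quad (fun K => c K + F K / 2 * secondMoment K) g fun K => -F K / 2,
      T.innerV_rt g h (fun K => -F K / 2), T.divh_rt,
      T.innerS_const_const, ← Finset.sum_add_distrib, ← T.green hΩ hu.1 hq]
    refine Finset.sum_congr rfl fun K _ => ?_
    ring
  · choose e he using hv
    have : v = fun K _ => e K := funext fun K => funext (he K)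
    rw [this, T.sol_eq_quad,
      T.gradh_quad (fun K => c K + F K / 2 * secondMoment K) g fun K => -F K / 2,
      T.divh_rt g fun K => -F K / 2, T.innerS_const_const, T.innerS_const_const,
      ← Finset.sum_neg_distrib]
    refine Finset.sum_congr rfl fun K _ => ?_
    ring

theorem isMixedSolution_unique (hΩ : IsConvexPolygonalDomain Ω) {F : T.elems → ℝ}
    {p p' : T.BrokenField} {u u' : T.BrokenFun} (hp : T.IsMixedSolution (fun K _ => F K) p u)
    (hp' : T.IsMixedSolution (fun K _ => F K) p' u') : p = p' ∧ u = u' := by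
  obtain ⟨hW, hX, h1, h2⟩ := hp
  obtain ⟨hW', hX', h1', h2'⟩ := hp'
  obtain ⟨h, d, rfl⟩ := T.exists_rt_of_mem_W hW
  obtain ⟨h', d', rfl⟩ := T.exists_rt_of_mem_W hW'
  choose e he using hX
  choose e' he' using hX'
  obtain rfl : u = fun K _ => e K := funext fun K => funext (he K)
  obtain rfl : u' = fun K _ => e' K := funext fun K => funext (he' K)
  have hdiv : d = d' := by
    have hv : (fun K _ => d K - d' K : T.BrokenFun) ∈ T.X := fun K => ⟨_, fun _ => rfl⟩
    have := (h2 _ hv).trans (h2' _ hv).symm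
    rw [T.divh_rt, T.divh_rt, T.innerS_const_const _ fun K => d K - d' K,
      T.innerS_const_const _ fun K => d K - d' K, ← sub_eq_zero, ← Finset.sum_sub_distrib] at this
    ext1 K
    have h3 := sum_mul_eq_zero (w := fun K : T.elems => volume.real (tri K.1) * 2)
      (x := fun K => (d K - d' K) ^ 2)
      (fun K => mul_pos (T.volume_pos K) two_pos) (fun K => sq_nonneg _)
      (by rw [← this]; exact Finset.sum_congr rfl fun K _ => by ring) K
    exact sub_eq_zero.1 (pow_eq_zero_iff two_ne_zero |>.1 h3)
  subst hdiv
  have htest : ∀ (k : T.elems → Plane) (s : T.elems → ℝ),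
      (fun K : T.elems => rt K (k K) (s K) : T.BrokenField) ∈ T.W →
      ∑ K : T.elems, volume.real (tri K.1) *
        (inner ℝ (h K - h' K) (k K) + 2 * s K * (e K - e' K)) = 0 := by
    intro k s hq
    have := (h1 _ hq).trans (h1' _ hq).symm
    rw [T.divh_rt, T.innerV_rt, T.innerV_rt, T.innerS_const_const, T.innerS_const_const,
      ← sub_eq_zero, ← Finset.sum_add_distrib, ← Finset.sum_add_distrib,
      ← Finset.sum_sub_distrib] at this
    rw [← this]
    refine Finset.sum_congr rfl fun K _ => ?_
    rw [inner_sub_left]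
    ring
  have hh : h = h' := by
    have hq : (fun K : T.elems => rt K (h K - h' K) ((fun _ => 0 : T.elems → ℝ) K) : T.BrokenField)
        ∈ T.W := by
      convert T.W.sub_mem hW hW' using 1
      ext1 K
      rw [Pi.sub_apply, rt_sub, sub_self]
    have h3 := htest _ _ hq
    simp only [mul_zero, zero_mul, add_zero] at h3
    ext1 K
    exact sub_eq_zero.1 (inner_self_eq_zero.1
      (sum_mul_eq_zero T.volume_pos (fun K => real_inner_self_nonneg) h3 K))
  subst hh
  refine ⟨rfl, ?_⟩
  -- Once the fluxes agree, a test field with divergence `-(e - e')` is needed; the Galerkin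
  -- solution with load `e - e'` provides one in `W`.
  obtain ⟨v, hv⟩ := T.exists_galerkin_V hΩ fun K => e K - e' K
  obtain ⟨c, g, rfl⟩ := T.exists_quad_of_mem_V hv.1
  have h3 := htest _ (fun K => -(e K - e' K) / 2)
    (T.rt_mem_W_of_galerkin (F := fun K => e K - e' K) hΩ hv)
  ext K x
  have h4 := sum_mul_eq_zero T.volume_pos (x := fun K => (e K - e' K) ^ 2) (fun K => sq_nonneg _)
    (by
      rw [← neg_eq_zero, ← Finset.sum_neg_distrib, ← h3]
      refine Finset.sum_congr rfl fun K _ => ?_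
      rw [sub_self, inner_zero_left]
      ring) K
  exact sub_eq_zero.1 (pow_eq_zero_iff two_ne_zero |>.1 h4)

end Triangulation

end CRMixed

end

open CRMixed MeasureTheory in
theorem mainTheorem4 (Ω : Set Plane) (hΩ : IsConvexPolygonalDomain Ω) (T : Triangulation Ω)
    (f : Plane → ℝ) (hf : MemLp f 2 (volume.restrict Ω)) :
    -- the three discrete problems are uniquely solvable, and the enriched space is a direct sum
    (∃! u, T.IsGalerkinSolution T.V (T.Qh fun _ => f) u) ∧
    (∃! a, T.IsGalerkinSolution T.VB (T.Qh fun _ => f) a) ∧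
    (∃! w, T.IsGalerkinSolution T.Vt (T.Qh fun _ => f) w) ∧
    Disjoint T.V T.VB ∧
    -- the local problems for the bubble coefficients
    (∀ (K : T.elems) (α : ℝ),
      α * (∫ x in tri K, inner ℝ (gradient (bubble K) x) (gradient (bubble K) x))
          = (∫ x in tri K, T.Qh (fun _ => f) K x * bubble K x) ↔
        α = -((∫ x in tri K, f x) / volume.real (tri K)) / 2) ∧
    ∀ u a w : T.BrokenFun,
      T.IsGalerkinSolution T.V (T.Qh fun _ => f) u →
      T.IsGalerkinSolution T.VB (T.Qh fun _ => f) a →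
      T.IsGalerkinSolution T.Vt (T.Qh fun _ => f) w →
      -- `∇_h w` and `Q_h w` form the unique solution of the mixed method
      (T.IsMixedSolution (T.Qh fun _ => f) (T.gradh w) (T.Qh w) ∧
        ∀ p ubar, T.IsMixedSolution (T.Qh fun _ => f) p ubar → p = T.gradh w ∧ ubar = T.Qh w) ∧
      -- decomposition and element-wise formulas
      w = u + a ∧
      ∀ (K : T.elems) (fK : ℝ), fK = (∫ x in tri K, f x) / volume.real (tri K) →
        ∀ x ∈ tri (K : Finset Plane),
          a K x = (-fK / 2) * bubble K x ∧
          w K x = u K x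
            - 1 / 4 * fK * (‖x - bary K‖ ^ 2 - 1 / 6 * ∑ v ∈ K.1, ‖v - bary K‖ ^ 2) ∧
          T.gradh w K x = T.gradh u K x - (1 / 2 * fK) • (x - bary K) ∧
          T.Qh w K x = u K (bary K)
            - 1 / 16 * fK * (‖bary K‖ ^ 2 - 1 / 3 * ∑ v ∈ K.1, ‖v‖ ^ 2) := by
  have hQ : (T.Qh fun _ => f) = fun K _ => T.mean (fun _ => f) K := rfl
  rw [hQ]
  set F : T.elems → ℝ := T.mean fun _ => f with hF
  obtain ⟨u₀, hu₀⟩ := T.exists_galerkin_V hΩ F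
  refine ⟨⟨u₀, hu₀, fun v hv => T.galerkin_V_unique hΩ hv hu₀⟩,
    ⟨T.bubbleSol F, T.galerkin_VB_iff.2 rfl, fun a ha => T.galerkin_VB_iff.1 ha⟩,
    ⟨u₀ + T.bubbleSol F, T.galerkin_Vt_iff.2 ⟨u₀, hu₀, rfl⟩, fun w hw => ?_⟩,
    T.disjoint_V_VB, fun K α => ?_, fun u a w hu ha hw => ?_⟩
  · obtain ⟨u, hu, rfl⟩ := T.galerkin_Vt_iff.1 hw
    rw [T.galerkin_V_unique hΩ hu hu₀]
  · have hK := T.isTriangle K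
    change _ ↔ α = -F K / 2
    simp only [bubble_eq_quad, gradient_quad, integral_const_mul, hK.setIntegral_inner_rt,
      hK.setIntegral_quad, inner_zero_left]
    have hpos := mul_pos (T.volume_pos K) (secondMoment_pos hK)
    constructor
    · intro h
      refine mul_right_cancel₀ hpos.ne' ?_
      linear_combination h
    · rintro rfl
      ring
  · refine ⟨⟨T.isMixedSolution_of_galerkin hΩ hw, fun p ubar hp =>
      T.isMixedSolution_unique hΩ hp (T.isMixedSolution_of_galerkin hΩ hw)⟩, ?_⟩
    obtain ⟨u', hu', rfl⟩ := T.galerkin_Vt_iff.1 hw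
    obtain rfl := T.galerkin_V_unique hΩ hu' hu
    obtain rfl := T.galerkin_VB_iff.1 ha
    refine ⟨rfl, ?_⟩
    intro K fK hfK x _
    obtain rfl : fK = F K := hfK
    obtain ⟨c, g, rfl⟩ := T.exists_quad_of_mem_V hu.1
    have hgu : T.gradh (fun K : T.elems => quad K (c K) (g K) 0) K x = g K := by
      rw [T.gradh_quad c g fun _ => 0]
      simp [rt]
    refine ⟨?_, ?_, ?_, ?_⟩
    · rw [bubble_eq_quad]
      simp only [Triangulation.bubbleSol, quad, inner_zero_left]
      ring
    · rw [Pi.add_apply, Pi.add_apply]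
      simp only [Triangulation.bubbleSol, quad, inner_zero_left, secondMoment]
      ring
    · rw [hgu, T.sol_eq_quad,
        T.gradh_quad (fun K => c K + F K / 2 * secondMoment K) g fun K => -F K / 2]
      simp only [rt]
      module
    · rw [T.sol_eq_quad,
        T.Qh_quad (fun K => c K + F K / 2 * secondMoment K) g fun K => -F K / 2]
      simp only [quad_bary, (T.isTriangle K).secondMoment_eq]
      ring
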